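/- **Setting.** Let $\mathcal{A}\subset\mathbb{R}^d$ be finite, $\mathcal{Y}$ a measurable space of outcomes (for instance a subset of a Euclidean space), $R:\mathcal{Y}\to\mathbb{R}$ a measurable reward function with $\sup R-\inf R\le 1$, and $\mathcal{P}$ a family of probability distributions on $\mathcal{Y}^{\mathcal{A}}$; for $p\in\mathcal P$ let $p_a$ be the marginal of the coordinate $a$. On a probability space, let $p^*$ be a random element of $\mathcal{P}$ and let $Y_t=(Y_{t,a})_{a\in\mathcal{A}}$, $t\ge 1$, be i.i.d. with law $p^*$ conditionally on $p^*$. Let $A^*$ be an optimal action, that is, a measurable function of $p^*$ with $A^*\in\arg\max_{a\in\mathcal{A}}\mathbb{E}_{y\sim p^*_a}[R(y)]$ almost surely. Let $(U_t)_{t\ge1}$ be random variables such that each $U_i$ is independent of the collection formed by $(U_t)_{t\ne i}$, $(Y_t)_{t\ge1}$ and $p^*$. Let $\mathcal{F}_t$ be the $\sigma$-algebra generated by $A_1,Y_{1,A_1},\dots,A_{t-1},Y_{t-1,A_{t-1}}$, where the action $A_t\in\mathcal{A}$ of period $t$ is measurable with respect to $\sigma(\mathcal{F}_t,U_t)$ and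 is chosen by Thompson sampling: $\mathbb{P}(A_t=a\mid\mathcal{F}_t)=\mathbb{P}(A^*=a\mid\mathcal{F}_t)$ almost surely for all $a\in\mathcal{A}$ and $t\ge 1$. Write $H(A^*)=-\sum_{a}\mathbb{P}(A^*=a)\log\mathbb{P}(A^*=a)$, $Z_t=(A_t,Y_{t,A_t})$, and $$H_t(A^*)=-\sum_{a}\mathbb{P}(A^*=a\mid\mathcal{F}_t)\log\mathbb{P}(A^*=a\mid\mathcal{F}_t),$$ $$I_t(A^*;Z_t)=H_t(A^*)-\mathbb{E}\Big[-\sum_{a}\mathbb{P}(A^*=a\mid\mathcal{F}_t,Z_t)\log\mathbb{P}(A^*=a\mid\mathcal{F}_t,Z_t)\,\Big|\,\mathcal{F}_t\Big],$$ with $0\log 0=0$. The information ratio is $$\Gamma_t=\frac{\big(\mathbb{E}[R(Y_{t,A^*})-R(Y_{t,A_t})\mid\mathcal{F}_t]\big)^2}{I_t(A^*;Z_t)}\in[0,\infty],$$ where $0/0=0$ and $x/0=\infty$ for $x>0$. **Proposition 5.** Suppose that for each $p\in\mathcal{P}$ there is $\theta_p\in\mathbb{R}^d$ such that $\mathbb{E}_{y\sim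 p_a}[R(y)]=a^{T}\theta_p$ for all $a\in\mathcal{A}$. Then for every $t\ge1$, $\Gamma_t\le d/2$ almost surely. Moreover, for every $T\in\mathbb{N}$, $$\mathbb{E}\Big[\sum_{t=1}^{T}\big(R(Y_{t,A^*})-R(Y_{t,A_t})\big)\Big]\le\sqrt{\tfrac12\,H(A^*)\,d\,T}.$$ -/

import Mathlib

open MeasureTheory ProbabilityTheory
open scoped ENNReal

noncomputable section

namespace ThompsonSampling

/-- The marginal `p_a`, for a distribution `p` of the vector of outcomes `(y_a)_a`. -/
def marginal {𝒜 𝒴 : Type*} [MeasurableSpace 𝒴] (p : Measure (𝒜 → 𝒴)) (a : 𝒜) : Measure 𝒴 :=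
  p.map (fun y => y a)

/-- The sigma-algebra `F_t` of the history before period `t`, generated by the pairs
`(A_s, Y_{s, A_s})` with `s < t`.  Periods are numbered from `0`, so `F_0` is trivial. -/
abbrev history {Ω 𝒜 𝒴 : Type*} [MeasurableSpace 𝒜] [MeasurableSpace 𝒴]
    (Y : ℕ → Ω → 𝒜 → 𝒴) (A : ℕ → Ω → 𝒜) (t : ℕ) : MeasurableSpace Ω :=
  ⨆ (s : ℕ) (_ : s < t),
    MeasurableSpace.comap (fun ω => (A s ω, Y s ω (A s ω))) inferInstance

/-- A Bayesian online optimization problem on the probability space `(Ω, μ)`, with actions in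
`𝒜` and outcomes in `𝒴`, together with a sequence of actions chosen by a randomized policy. -/
structure OnlineProblem {Ω : Type*} [MeasurableSpace Ω] (μ : Measure Ω)
    (𝒜 𝒴 𝒰 : Type*) [MeasurableSpace 𝒜] [MeasurableSpace 𝒴] [MeasurableSpace 𝒰] where
  /-- the family of candidate distributions of the vector of outcomes -/
  family : Set (Measure (𝒜 → 𝒴))
  family_prob : ∀ p ∈ family, IsProbabilityMeasure p
  /-- the random true distribution `p*` -/
  pstar : Ω → Measure (𝒜 → 𝒴)
  measurable_pstar : Measurable pstar
  pstar_mem : ∀ ω, pstar ω ∈ family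
  /-- `Y t ω a` is the outcome of action `a` in period `t` -/
  Y : ℕ → Ω → 𝒜 → 𝒴
  measurable_Y : ∀ t, Measurable (Y t)
  /-- conditionally on `p*`, the vectors `Y t` are independent with common law `p*` -/
  cond_iid : ∀ (s : Finset ℕ) (B : ℕ → Set (𝒜 → 𝒴)), (∀ t ∈ s, MeasurableSet (B t)) →
    μ⟦⋂ t ∈ s, Y t ⁻¹' B t | MeasurableSpace.comap pstar inferInstance⟧
      =ᵐ[μ] fun ω => ∏ t ∈ s, (pstar ω).real (B t)
  /-- the reward function -/
  R : 𝒴 → ℝ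
  measurable_R : Measurable R
  /-- the optimal action `A*`, a function of `p*` maximizing the mean reward under `p*` -/
  Astar : Ω → 𝒜
  measurable_Astar : Measurable[MeasurableSpace.comap pstar inferInstance] Astar
  Astar_optimal : ∀ᵐ ω ∂μ, ∀ a : 𝒜,
    ∫ y, R y ∂(marginal (pstar ω) a) ≤ ∫ y, R y ∂(marginal (pstar ω) (Astar ω))
  /-- the external randomness: `U i` is independent of all `U j` with `j ≠ i`, all outcomes and
  `p*`, jointly -/
  U : ℕ → Ω → 𝒰
  measurable_U : ∀ t, Measurable (U t)
  indep_U : ∀ i, Indep (MeasurableSpace.comap (U i) inferInstance)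
    ((⨆ (j : ℕ) (_ : j ≠ i), MeasurableSpace.comap (U j) inferInstance) ⊔
      (⨆ t : ℕ, MeasurableSpace.comap (Y t) inferInstance) ⊔
      MeasurableSpace.comap pstar inferInstance) μ
  /-- the action in period `t` depends only on the history and on `U t` -/
  A : ℕ → Ω → 𝒜
  measurable_A : ∀ t,
    Measurable[history Y A t ⊔ MeasurableSpace.comap (U t) inferInstance] (A t)

/-- Shannon entropy (natural logarithm) `-∑ P(X = x) log P(X = x)`. -/
def entropy {Ω 𝒳 : Type*} [MeasurableSpace Ω] (μ : Measure Ω) [Fintype 𝒳] (X : Ω → 𝒳) : ℝ :=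
  ∑ x, Real.negMulLog (μ.real (X ⁻¹' {x}))

/-- Entropy of `X` under the posterior measure given the sigma-algebra `m`. -/
def postEntropy {Ω 𝒳 : Type*} [Fintype 𝒳] (m : MeasurableSpace Ω) [MeasurableSpace Ω]
    (μ : Measure Ω) (X : Ω → 𝒳) (ω : Ω) : ℝ :=
  ∑ x, Real.negMulLog ((μ⟦X ⁻¹' {x} | m⟧) ω)

/-- Conditional entropy of `X` given `Z` under the posterior measure given `m`: the conditional
expectation given `m` of the entropy of the posterior given `m` and `Z`. -/
def postCondEntropy {Ω 𝒳 𝒵 : Type*} [Fintype 𝒳] [MeasurableSpace 𝒵]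
    (m : MeasurableSpace Ω) [MeasurableSpace Ω] (μ : Measure Ω) (X : Ω → 𝒳) (Z : Ω → 𝒵) : Ω → ℝ :=
  μ[postEntropy (m ⊔ MeasurableSpace.comap Z inferInstance) μ X | m]

/-- Mutual information of `X` and `Z` under the posterior measure given `m`. -/
def postMutualInfo {Ω 𝒳 𝒵 : Type*} [Fintype 𝒳] [MeasurableSpace 𝒵]
    (m : MeasurableSpace Ω) [MeasurableSpace Ω] (μ : Measure Ω) (X : Ω → 𝒳) (Z : Ω → 𝒵) (ω : Ω) : ℝ :=
  postEntropy m μ X ω - postCondEntropy m μ X Z ω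

namespace OnlineProblem

variable {Ω : Type*} [MeasurableSpace Ω] {μ : Measure Ω}
  {𝒜 𝒴 𝒰 : Type*} [MeasurableSpace 𝒜] [MeasurableSpace 𝒴] [MeasurableSpace 𝒰]

/-- The sigma-algebra `F_t`. -/
abbrev hist (P : OnlineProblem μ 𝒜 𝒴 𝒰) (t : ℕ) : MeasurableSpace Ω :=
  history P.Y P.A t

/-- The range of the reward function is at most `1`. -/
def RewardRangeLeOne (P : OnlineProblem μ 𝒜 𝒴 𝒰) : Prop :=
  ∀ y y' : 𝒴, P.R y - P.R y' ≤ 1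

/-- The actions are chosen by Thompson sampling: the conditional law of `A_t` given the history
is the posterior law of the optimal action. -/
def IsThompson (P : OnlineProblem μ 𝒜 𝒴 𝒰) : Prop :=
  ∀ (t : ℕ) (a : 𝒜),
    μ⟦P.A t ⁻¹' {a} | P.hist t⟧ =ᵐ[μ] μ⟦P.Astar ⁻¹' {a} | P.hist t⟧

/-- The regret `R(Y_{t, A*}) - R(Y_{t, A_t})` of period `t`. -/
def regretAt (P : OnlineProblem μ 𝒜 𝒴 𝒰) (t : ℕ) (ω : Ω) : ℝ :=
  P.R (P.Y t ω (P.Astar ω)) - P.R (P.Y t ω (P.A t ω))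

/-- The cumulative regret of the first `T` periods. -/
def regret (P : OnlineProblem μ 𝒜 𝒴 𝒰) (T : ℕ) (ω : Ω) : ℝ :=
  ∑ t ∈ Finset.range T, P.regretAt t ω

/-- The information gain `I_t(A*; (A_t, Y_{t, A_t}))`. -/
def infoGain [Fintype 𝒜] (P : OnlineProblem μ 𝒜 𝒴 𝒰) (t : ℕ) : Ω → ℝ :=
  postMutualInfo (P.hist t) μ P.Astar (fun ω => (P.A t ω, P.Y t ω (P.A t ω)))

/-- The information ratio `Γ_t`, the squared conditional expected regret over the information
gain.  It takes values in `[0, ∞]`, where `0 / 0 = 0` and `x / 0 = ∞` for `x > 0`. -/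
def infoRatio [Fintype 𝒜] (P : OnlineProblem μ 𝒜 𝒴 𝒰) (t : ℕ) (ω : Ω) : ℝ≥0∞ :=
  ENNReal.ofReal ((μ[P.regretAt t | P.hist t]) ω ^ 2) / ENNReal.ofReal (P.infoGain t ω)

end OnlineProblem

end ThompsonSampling

end

/-! Fix a period and work under the posterior given the history. Let `α` be the posterior law of the
optimal action and `N a b` the posterior covariance of the reward of `a` with the indicator that `b`
is optimal. Given the history, the played action is independent of the optimal action and the
outcomes, and has law `α`, so the expected regret is the trace of `N`. Each column of `N` lies in
the space of mean-reward vectors, of dimension at most `d`. Conjugating by `diag (√α)` keeps the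
trace and this dimension bound, so the squared regret is at most `d` times `∑ α a * N a b ^ 2 / α b`
(`sq_trace_le_mul_sum_sq`).

It remains to bound twice that sum by the information gain, a Pinsker-type inequality. Conditional
laws are avoided: `u log u` is bounded below by affine functions of `u` whose slopes depend on the
observed action and reward (`sum_dual_le_condExp`), and the parameters are optimised pointwise with
Hoeffding's lemma (`sq_sum_le_of_forall_dual`). This gives `d / 2` in `sq_condExp_regretAt_le`.

The gains telescope to at most the prior entropy, and Jensen and Cauchy-Schwarz give the regret
bound. -/

namespace ThompsonSampling

/-! ### Scalar inequalities for `exp` and `u log u`. -/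

/-- **Hoeffding's lemma** for a Bernoulli variable, in closed form. -/
lemma one_add_mul_exp_sub_one_le {p : ℝ} (hp0 : 0 ≤ p) (hp1 : p ≤ 1) (l : ℝ) :
    1 + p * (Real.exp l - 1) ≤ Real.exp (l * p + l ^ 2 / 8) := by
  set ν : Measure ℝ := ENNReal.ofReal p • Measure.dirac 1 + ENNReal.ofReal (1 - p) • Measure.dirac 0
    with hν
  have hprob : IsProbabilityMeasure ν := by
    constructor
    simp only [hν, Measure.add_apply, Measure.smul_apply, measure_univ, smul_eq_mul, mul_one]
    rw [← ENNReal.ofReal_add hp0 (by linarith)]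
    simp
  have hInt : ∀ f : ℝ → ℝ, ∫ x, f x ∂ν = p * f 1 + (1 - p) * f 0 := by
    intro f
    have h1 : ∀ x : ℝ, ∀ q : ℝ, Integrable f (ENNReal.ofReal q • Measure.dirac x) := fun x q =>
      (integrable_dirac (by simp)).smul_measure ENNReal.ofReal_ne_top
    rw [hν, integral_add_measure (h1 _ _) (h1 _ _), integral_smul_measure, integral_smul_measure,
      integral_dirac, integral_dirac, ENNReal.toReal_ofReal hp0,
      ENNReal.toReal_ofReal (by linarith)]
    rfl
  have hae : ∀ᵐ x ∂ν, (fun x : ℝ => x) x ∈ Set.Icc (0 : ℝ) 1 := by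
    rw [hν, ae_add_measure_iff]
    constructor <;> refine Measure.ae_smul_measure ?_ _ <;> rw [ae_dirac_iff] <;>
      first | exact measurableSet_Icc | simp
  -- An interval of length `1` gives variance proxy `1/4`, hence `l ^ 2 / 8`. The bound concerns the
  -- centred variable; multiplying by `exp (l * p)` undoes the centring.
  have h := (hasSubgaussianMGF_of_mem_Icc (μ := ν) (X := fun x : ℝ => x) (a := 0) (b := 1)
    measurable_id.aemeasurable hae).mgf_le l
  rw [mgf, hInt, hInt] at h
  have e1 : Real.exp (l * (1 - p)) = Real.exp l * Real.exp (-(l * p)) := by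
    rw [← Real.exp_add]; ring_nf
  have e2 : Real.exp (l * p + l ^ 2 / 8) = Real.exp (l * p) * Real.exp (l ^ 2 / 8) := Real.exp_add _ _
  have e3 : Real.exp (l * p) * Real.exp (-(l * p)) = 1 := by rw [← Real.exp_add]; simp
  have h' : (1 + p * (Real.exp l - 1)) * Real.exp (-(l * p)) ≤ Real.exp (l ^ 2 / 8) := by
    refine le_trans (le_of_eq ?_) (h.trans (le_of_eq ?_))
    · simp only [mul_one, mul_zero, add_zero, zero_sub, mul_neg, e1]
      ring
    · congr 1
      simp
      ring
  calc 1 + p * (Real.exp l - 1)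
      = Real.exp (l * p) * ((1 + p * (Real.exp l - 1)) * Real.exp (-(l * p))) := by
        rw [mul_comm (1 + _), ← mul_assoc, e3, one_mul]
    _ ≤ _ := by rw [e2]; gcongr

/-- The chord of `exp` lies above its graph. -/
lemma exp_mul_le_one_add {r : ℝ} (h0 : 0 ≤ r) (h1 : r ≤ 1) (l : ℝ) :
    Real.exp (l * r) ≤ 1 + r * (Real.exp l - 1) := by
  have h := convexOn_exp.2 (Set.mem_univ l) (Set.mem_univ 0) h0 (sub_nonneg.2 h1) (by ring)
  simp only [smul_eq_mul, mul_zero, add_zero, Real.exp_zero, mul_one] at h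
  rw [mul_comm l r]
  linarith

/-- The Fenchel-Young inequality for `u log u`. -/
lemma mul_sub_exp_le_neg_negMulLog {u : ℝ} (hu : 0 ≤ u) (y : ℝ) :
    u * y - Real.exp (y - 1) ≤ -Real.negMulLog u := by
  rcases hu.eq_or_lt with rfl | hu
  · simp [Real.exp_nonneg]
  -- Equality holds at `y = 1 + log u`, where this exponent vanishes.
  · have h := Real.add_one_le_exp (y - 1 - Real.log u)
    rw [Real.exp_sub, Real.exp_log hu, le_div_iff₀ hu] at h
    simp only [Real.negMulLog]
    linarith

/-! ### The bound for a fixed posterior. -/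

/-- The square of the trace of a matrix whose columns lie in a `d`-dimensional space is at most
`d` times the square of its Frobenius norm. -/
lemma sq_trace_le_mul_sum_sq {ι : Type*} [Fintype ι] {d : ℕ} (L : Submodule ℝ (ι → ℝ))
    (hL : Module.finrank ℝ L ≤ d) (D : ι → ι → ℝ) (hD : ∀ b, (fun a => D a b) ∈ L) :
    (∑ a, D a a) ^ 2 ≤ d * ∑ a, ∑ b, D a b ^ 2 := by
  classical
  let e := (WithLp.linearEquiv 2 ℝ (ι → ℝ)).symm
  let E : Submodule ℝ (EuclideanSpace ℝ ι) := L.map e.toLinearMap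
  have hE : Module.finrank ℝ E ≤ d := by
    have : Module.finrank ℝ E = Module.finrank ℝ L := LinearEquiv.finrank_map_eq e L
    omega
  let v : ι → E := fun b => ⟨e (fun a => D a b), Submodule.mem_map_of_mem (hD b)⟩
  -- Expanding the columns in this basis turns the trace into a sum over pairs (index, basis
  -- vector). Cauchy-Schwarz there has one factor equal to the dimension and the other to the
  -- squared Frobenius norm.
  let o := stdOrthonormalBasis ℝ E
  have hv : ∀ a b, D a b = ((v b : EuclideanSpace ℝ ι)) a := fun a b => rfl
  have hexp : ∀ b, D b b = ∑ j, inner ℝ (o j) (v b) * ((o j : EuclideanSpace ℝ ι) b) := by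
    intro b
    rw [hv]
    conv_lhs => rw [← o.sum_repr' (v b)]
    simp
  have hcol : ∀ b, ∑ a, D a b ^ 2 = ∑ j, (inner ℝ (o j) (v b)) ^ 2 := by
    intro b
    have h1 : ‖v b‖ ^ 2 = ∑ a, D a b ^ 2 := by
      rw [Submodule.coe_norm, EuclideanSpace.norm_sq_eq]
      simp [hv]
    rw [← h1, ← o.sum_sq_norm_inner_right]
    simp
  have hunit : ∀ j, ∑ b, ((o j : EuclideanSpace ℝ ι) b) ^ 2 = 1 := by
    intro j
    have h1 : ‖(o j : EuclideanSpace ℝ ι)‖ ^ 2 = 1 := by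
      rw [← Submodule.coe_norm, o.orthonormal.1 j]; simp
    rw [EuclideanSpace.norm_sq_eq] at h1
    simpa using h1
  have hcs := Finset.sum_mul_sq_le_sq_mul_sq (Finset.univ : Finset (ι × Fin (Module.finrank ℝ E)))
    (fun x => ((o x.2 : EuclideanSpace ℝ ι) x.1)) (fun x => inner ℝ (o x.2) (v x.1))
  have s1 : ∑ x : ι × Fin (Module.finrank ℝ E), ((o x.2 : EuclideanSpace ℝ ι) x.1) ^ 2
      = Module.finrank ℝ E := by
    rw [Fintype.sum_prod_type_right]
    simp [hunit]
  have s2 : ∑ x : ι × Fin (Module.finrank ℝ E), (inner ℝ (o x.2) (v x.1)) ^ 2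
      = ∑ a, ∑ b, D a b ^ 2 := by
    rw [Fintype.sum_prod_type, Finset.sum_comm (s := Finset.univ) (t := Finset.univ)
      (f := fun a b => D a b ^ 2)]
    simp [hcol]
  have s3 : ∑ x : ι × Fin (Module.finrank ℝ E),
      ((o x.2 : EuclideanSpace ℝ ι) x.1) * inner ℝ (o x.2) (v x.1) = ∑ a, D a a := by
    rw [Fintype.sum_prod_type]
    refine Finset.sum_congr rfl fun b _ => ?_
    rw [hexp b]
    exact Finset.sum_congr rfl fun j _ => mul_comm _ _
  rw [s1, s2, s3] at hcs
  refine hcs.trans ?_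
  have : (0 : ℝ) ≤ ∑ a, ∑ b, D a b ^ 2 := by positivity
  gcongr

/-- The information ratio bound for a fixed posterior: `α` is the posterior law of the optimal
action, `r a` the posterior mean reward of `a`, `M a b` the posterior mean of the reward of `a` on
the event that `b` is optimal, and `-e b` the expected entropy term of `b` after the observation. -/
lemma sq_sum_le_of_forall_dual {ι : Type*} [Fintype ι] {d : ℕ} (L : Submodule ℝ (ι → ℝ))
    (hL : Module.finrank ℝ L ≤ d) (α r e : ι → ℝ) (M : ι → ι → ℝ)
    (hα : ∀ a, 0 ≤ α a) (hα1 : ∑ a, α a = 1) (hr0 : ∀ a, 0 ≤ r a) (hr1 : ∀ a, r a ≤ 1)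
    (hM0 : ∀ a b, 0 ≤ M a b) (hM1 : ∀ a b, M a b ≤ α b)
    (hN : ∀ b, (fun a => M a b - α b * r a) ∈ L)
    (he : ∀ (b : ι) (l k : ι → ℝ), ∑ a, α a * (l a * M a b - k a * α b
      - Real.exp (-k a - 1) * (1 + r a * (Real.exp (l a) - 1))) ≤ e b) :
    (∑ a, (M a a - α a * r a)) ^ 2 ≤ d / 2 * ∑ b, (e b + Real.negMulLog (α b)) := by
  set N : ι → ι → ℝ := fun a b => M a b - α b * r a with hNdef
  have hN0 : ∀ a b, α b = 0 → N a b = 0 := by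
    intro a b h
    have h1 := hM0 a b
    have h2 := hM1 a b
    simp only [hNdef, h, zero_mul, sub_zero] at *
    linarith
  -- Conjugation by `diag (√α)`. Where `α b = 0` the inverse is `0` by convention, which is harmless
  -- because the column of `N` vanishes there.
  set D : ι → ι → ℝ := fun a b => √(α a) * ((√(α b))⁻¹ * N a b) with hDdef
  have htr : ∀ a, D a a = N a a := by
    intro a
    rcases (hα a).eq_or_lt with h | h
    · simp [hDdef, hN0 a a h.symm]
    · have : √(α a) ≠ 0 := (Real.sqrt_pos.2 h).ne'
      simp only [hDdef]
      field_simp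
  let S : (ι → ℝ) →ₗ[ℝ] (ι → ℝ) :=
    { toFun := fun x a => √(α a) * x a
      map_add' := fun x y => by ext a; simp [mul_add]
      map_smul' := fun c x => by ext a; simp; ring }
  have hfro := sq_trace_le_mul_sum_sq (L.map S) ((Submodule.finrank_map_le S L).trans hL) D
    (fun b => Submodule.mem_map.2 ⟨_, L.smul_mem (√(α b))⁻¹ (hN b), by
      ext a; simp [S, hDdef, hNdef]; ring⟩)
  simp only [htr] at hfro
  refine hfro.trans ?_
  have hcolb : ∀ b, 2 * ∑ a, D a b ^ 2 ≤ e b + Real.negMulLog (α b) := by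
    intro b
    rcases (hα b).eq_or_lt with h | h
    · have h0 : ∑ a, D a b ^ 2 = 0 := by simp [hDdef, hN0 _ b h.symm]
      rw [h0, ← h]
      simp only [mul_zero, Real.negMulLog_zero, add_zero]
      -- Only `0 ≤ e b` is needed. With `l = 0` and `k` constant the dual bound is `-exp (-k - 1)`,
      -- and `k` makes this `-ε`.
      refine le_of_forall_pos_le_add fun ε hε => ?_
      have h1 := he b 0 (fun _ => -Real.log ε - 1)
      simp only [Pi.zero_apply, zero_mul, ← h, mul_zero, zero_sub, Real.exp_zero,
        sub_self, add_zero, mul_one] at h1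
      rw [← Finset.sum_mul, hα1] at h1
      have h2 : Real.exp (-(-Real.log ε - 1) - 1) = ε := by
        rw [show -(-Real.log ε - 1) - 1 = Real.log ε by ring, Real.exp_log hε]
      rw [h2] at h1
      linarith
    -- After Hoeffding, the best `k` makes the exponential term equal to `α b`. What remains is `α b
    -- log (α b) + l N - α b l ^ 2 / 8`, maximal at `l = 4 N / α b` with excess `2 N ^ 2 / α b`.
    · set l : ι → ℝ := fun a => 4 * N a b / α b with hl
      have h1 := he b l (fun a => l a * r a + l a ^ 2 / 8 - Real.log (α b) - 1)
      have h2 : ∑ a, α a * (α b * Real.log (α b) + 2 * (N a b ^ 2 / α b)) ≤ e b := by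
        refine le_trans (Finset.sum_le_sum fun a _ => mul_le_mul_of_nonneg_left ?_ (hα a)) h1
        have h3 : Real.exp (-(l a * r a + l a ^ 2 / 8 - Real.log (α b) - 1) - 1)
            * (1 + r a * (Real.exp (l a) - 1)) ≤ α b := by
          have h4 := one_add_mul_exp_sub_one_le (hr0 a) (hr1 a) (l a)
          have h5 : Real.exp (-(l a * r a + l a ^ 2 / 8 - Real.log (α b) - 1) - 1)
              * Real.exp (l a * r a + l a ^ 2 / 8) = α b := by
            rw [← Real.exp_add, show -(l a * r a + l a ^ 2 / 8 - Real.log (α b) - 1) - 1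
              + (l a * r a + l a ^ 2 / 8) = Real.log (α b) by ring, Real.exp_log h]
          calc _ ≤ _ := mul_le_mul_of_nonneg_left h4 (Real.exp_nonneg _)
            _ = _ := h5
        have h6 : l a * M a b - (l a * r a + l a ^ 2 / 8 - Real.log (α b) - 1) * α b - α b
            = α b * Real.log (α b) + 2 * (N a b ^ 2 / α b) := by
          simp only [hl, hNdef]
          field_simp
          ring
        linarith
      have h3 : ∑ a, α a * (α b * Real.log (α b) + 2 * (N a b ^ 2 / α b))
          = -Real.negMulLog (α b) + 2 * ∑ a, D a b ^ 2 := by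
        simp only [mul_add, Finset.sum_add_distrib]
        rw [← Finset.sum_mul, hα1, Finset.mul_sum]
        congr 1
        · simp [Real.negMulLog]
        · refine Finset.sum_congr rfl fun a _ => ?_
          simp only [hDdef, mul_pow, inv_pow, Real.sq_sqrt (hα a), Real.sq_sqrt h.le]
          ring
      linarith
  rw [Finset.sum_comm]
  have h1 := Finset.sum_le_sum fun b (_ : b ∈ Finset.univ) => hcolb b
  rw [← Finset.mul_sum] at h1
  have h2 : (0 : ℝ) ≤ d / 2 := by positivity
  calc _ = (d / 2 : ℝ) * (2 * ∑ b, ∑ a, D a b ^ 2) := by ring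
    _ ≤ _ := by gcongr

/-! ### Conditional expectation and independent information. -/

section CondExp

variable {Ω : Type*} {m u g m₁ m₂ m₀ : MeasurableSpace Ω} {μ : Measure Ω} [IsProbabilityMeasure μ]

/-- A conditional expectation given `m₁ ⊔ m₂` is characterized by its integrals over the
intersections of members of generating π-systems. -/
lemma ae_eq_condExp_sup_of_forall_setIntegral_inter_eq
    (h₁ : m₁ ≤ m₀) (h₂ : m₂ ≤ m₀) {S₁ S₂ : Set (Set Ω)}
    (hS₁ : m₁ = MeasurableSpace.generateFrom S₁) (hS₂ : m₂ = MeasurableSpace.generateFrom S₂)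
    (hpi₁ : IsPiSystem S₁) (hpi₂ : IsPiSystem S₂) (hu₁ : Set.univ ∈ S₁) (hu₂ : Set.univ ∈ S₂)
    {f h : Ω → ℝ} (hf : Integrable f μ) (hh : Integrable h μ)
    (hhm : StronglyMeasurable[m₁ ⊔ m₂] h)
    (heq : ∀ s ∈ S₁, ∀ t ∈ S₂, ∫ ω in s ∩ t, h ω ∂μ = ∫ ω in s ∩ t, f ω ∂μ) :
    h =ᵐ[μ] μ[f | m₁ ⊔ m₂] := by
  have hle : m₁ ⊔ m₂ ≤ m₀ := sup_le h₁ h₂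
  have hgen : m₁ ⊔ m₂ = MeasurableSpace.generateFrom (Set.image2 (· ∩ ·) S₁ S₂) := by
    apply le_antisymm
    · refine sup_le ?_ ?_
      · rw [hS₁]
        exact MeasurableSpace.generateFrom_mono fun s hs => ⟨s, hs, Set.univ, hu₂, by simp⟩
      · rw [hS₂]
        exact MeasurableSpace.generateFrom_mono fun t ht => ⟨Set.univ, hu₁, t, ht, by simp⟩
    · refine MeasurableSpace.generateFrom_le ?_
      rintro _ ⟨s, hs, t, ht, rfl⟩
      refine MeasurableSet.inter ?_ ?_
      · exact le_sup_left (a := m₁) (b := m₂) _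
          (hS₁ ▸ MeasurableSpace.measurableSet_generateFrom hs)
      · exact le_sup_right (a := m₁) (b := m₂) _
          (hS₂ ▸ MeasurableSpace.measurableSet_generateFrom ht)
  have hpi : IsPiSystem (Set.image2 (· ∩ ·) S₁ S₂) := by
    rintro _ ⟨s, hs, t, ht, rfl⟩ _ ⟨s', hs', t', ht', rfl⟩ hne
    refine ⟨s ∩ s', hpi₁ _ hs _ hs' (hne.mono ?_), t ∩ t', hpi₂ _ ht _ ht' (hne.mono ?_), ?_⟩
    · exact fun x hx => ⟨hx.1.1, hx.2.1⟩
    · exact fun x hx => ⟨hx.1.2, hx.2.2⟩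
    · exact Set.inter_inter_inter_comm _ _ _ _
  have huniv : ∫ ω, h ω ∂μ = ∫ ω, f ω ∂μ := by
    simpa using heq _ hu₁ _ hu₂
  refine ae_eq_condExp_of_forall_setIntegral_eq hle hf (fun _ _ _ => hh.integrableOn)
    (fun s hs _ => ?_) hhm.aestronglyMeasurable
  induction s, hs using MeasurableSpace.induction_on_inter hgen hpi with
  | empty => simp
  | basic t ht =>
    obtain ⟨s, hs, t, ht, rfl⟩ := ht
    exact heq s hs t ht
  | compl t ht ih =>
    have ih := ih (measure_lt_top _ _)
    have hh' := integral_add_compl (hle _ ht) hh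
    have hf' := integral_add_compl (hle _ ht) hf
    linarith
  | iUnion s hd hs ih =>
    rw [integral_iUnion (fun i => hle _ (hs i)) hd hh.integrableOn,
      integral_iUnion (fun i => hle _ (hs i)) hd hf.integrableOn]
    exact tsum_congr fun i => ih i (measure_lt_top _ _)

/-- The integral over the intersection with an independent event. -/
lemma setIntegral_inter_of_indep (hu : u ≤ m₀) (hg : g ≤ m₀)
    (hind : Indep u g μ) {W : Ω → ℝ} (hW : StronglyMeasurable[g] W) (hWi : Integrable W μ)
    {s t : Set Ω} (hs : MeasurableSet[g] s) (ht : MeasurableSet[u] t) :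
    ∫ ω in s ∩ t, W ω ∂μ = μ.real t * ∫ ω in s, W ω ∂μ := by
  have h := condExp_indep_eq hg hu (hW.indicator hs) hind.symm
  rw [Set.inter_comm, ← setIntegral_indicator (hg _ hs),
    ← setIntegral_condExp hu (hWi.indicator (hg _ hs)) ht,
    setIntegral_congr_ae (hu _ ht) (h.mono fun ω hω _ => hω), setIntegral_const,
    integral_indicator (hg _ hs)]
  rfl

/-- Independent information does not change a conditional expectation. -/
lemma condExp_sup_of_indep (hm : m ≤ g) (hg : g ≤ m₀) (hu : u ≤ m₀)
    (hind : Indep u g μ) {W : Ω → ℝ} (hW : StronglyMeasurable[g] W) (hWi : Integrable W μ) :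
    μ[W | m ⊔ u] =ᵐ[μ] μ[W | m] := by
  refine (ae_eq_condExp_sup_of_forall_setIntegral_inter_eq (hm.trans hg) hu
    (S₁ := {s | MeasurableSet[m] s}) (S₂ := {s | MeasurableSet[u] s})
    (@MeasurableSpace.generateFrom_measurableSet Ω m).symm
    (@MeasurableSpace.generateFrom_measurableSet Ω u).symm
    (@MeasurableSpace.isPiSystem_measurableSet Ω m) (@MeasurableSpace.isPiSystem_measurableSet Ω u)
    .univ .univ hWi integrable_condExp
    (stronglyMeasurable_condExp.mono le_sup_left) ?_).symm
  intro s hs t ht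
  rw [setIntegral_inter_of_indep hu hg hind (stronglyMeasurable_condExp.mono hm)
    integrable_condExp (hm _ hs) ht, setIntegral_inter_of_indep hu hg hind hW hWi (hm _ hs) ht,
    setIntegral_condExp (hm.trans hg) hWi hs]

/-- A variable built from `m` and independent information is conditionally uncorrelated with the
variables measurable with respect to `g`. -/
lemma condExp_mul_of_indep (hm : m ≤ g) (hg : g ≤ m₀) (hu : u ≤ m₀)
    (hind : Indep u g μ) {V W : Ω → ℝ} (hW : StronglyMeasurable[g] W) (hWi : Integrable W μ)
    (hV : StronglyMeasurable[m ⊔ u] V) {c : ℝ} (hVc : ∀ ω, ‖V ω‖ ≤ c) :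
    μ[V * W | m] =ᵐ[μ] μ[V | m] * μ[W | m] := by
  have hmu : m ⊔ u ≤ m₀ := sup_le (hm.trans hg) hu
  have hVm : AEStronglyMeasurable V μ := (hV.mono hmu).aestronglyMeasurable
  have hVi : Integrable V μ := Integrable.of_bound hVm c (ae_of_all _ hVc)
  have hbm : ∀ {F : Ω → ℝ}, Integrable F μ → Integrable (V * F) μ := fun hF =>
    hF.bdd_mul hVm (ae_of_all _ hVc)
  -- Given `m ⊔ u` the factor `V` is known, while `u` adds nothing to the prediction of `W`.
  have h1 : μ[V * W | m ⊔ u] =ᵐ[μ] V * μ[W | m] :=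
    (condExp_mul_of_stronglyMeasurable_left hV (hbm hWi) hWi).trans
      ((condExp_sup_of_indep hm hg hu hind hW hWi).mono fun ω hω => by simp [hω])
  calc μ[V * W | m] =ᵐ[μ] μ[μ[V * W | m ⊔ u] | m] :=
        (condExp_condExp_of_le le_sup_left hmu).symm
    _ =ᵐ[μ] μ[V * μ[W | m] | m] := condExp_congr_ae h1
    _ =ᵐ[μ] μ[V | m] * μ[W | m] :=
        condExp_mul_of_stronglyMeasurable_right stronglyMeasurable_condExp
          (hbm integrable_condExp) hVi

end CondExp

/-! ### The law of an outcome given `p*` and the past. -/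

namespace OnlineProblem

variable {Ω : Type*} [MeasurableSpace Ω] {μ : Measure Ω}
  {𝒜 𝒴 𝒰 : Type*} [MeasurableSpace 𝒜] [MeasurableSpace 𝒴] [MeasurableSpace 𝒰]

/-- The sigma-algebra generated by `p*`. -/
abbrev sigmaPstar (P : OnlineProblem μ 𝒜 𝒴 𝒰) : MeasurableSpace Ω :=
  MeasurableSpace.comap P.pstar inferInstance

/-- The sigma-algebra generated by the outcome vectors before period `t`. -/
abbrev sigmaPastY (P : OnlineProblem μ 𝒜 𝒴 𝒰) (t : ℕ) : MeasurableSpace Ω :=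
  ⨆ s ∈ Set.Iio t, MeasurableSpace.comap (P.Y s) inferInstance

/-- The sigma-algebra generated by `p*`, the outcome vectors before period `t` and the external
randomness before period `s`. -/
abbrev sigmaPast (P : OnlineProblem μ 𝒜 𝒴 𝒰) (t s : ℕ) : MeasurableSpace Ω :=
  P.sigmaPstar ⊔ P.sigmaPastY t ⊔ ⨆ j ∈ Set.Iio s, MeasurableSpace.comap (P.U j) inferInstance

/-- The sigma-algebra of all random quantities except `U i`. -/
abbrev sigmaWithout (P : OnlineProblem μ 𝒜 𝒴 𝒰) (i : ℕ) : MeasurableSpace Ω :=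
  (⨆ (j : ℕ) (_ : j ≠ i), MeasurableSpace.comap (P.U j) inferInstance) ⊔
    (⨆ t : ℕ, MeasurableSpace.comap (P.Y t) inferInstance) ⊔ P.sigmaPstar

lemma sigmaPstar_le (P : OnlineProblem μ 𝒜 𝒴 𝒰) : P.sigmaPstar ≤ ‹MeasurableSpace Ω› :=
  P.measurable_pstar.comap_le

lemma sigmaPastY_le (P : OnlineProblem μ 𝒜 𝒴 𝒰) (t : ℕ) : P.sigmaPastY t ≤ ‹MeasurableSpace Ω› :=
  iSup₂_le fun s _ => (P.measurable_Y s).comap_le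

lemma sigmaWithout_le (P : OnlineProblem μ 𝒜 𝒴 𝒰) (i : ℕ) :
    P.sigmaWithout i ≤ ‹MeasurableSpace Ω› :=
  sup_le (sup_le (iSup₂_le fun j _ => (P.measurable_U j).comap_le)
    (iSup_le fun t => (P.measurable_Y t).comap_le)) P.sigmaPstar_le

lemma comap_Y_le_sigmaWithout (P : OnlineProblem μ 𝒜 𝒴 𝒰) (t i : ℕ) :
    MeasurableSpace.comap (P.Y t) inferInstance ≤ P.sigmaWithout i :=
  (le_iSup (fun t => MeasurableSpace.comap (P.Y t) inferInstance) t).trans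
    (le_sup_right.trans le_sup_left)

lemma sigmaPstar_le_sigmaWithout (P : OnlineProblem μ 𝒜 𝒴 𝒰) (i : ℕ) :
    P.sigmaPstar ≤ P.sigmaWithout i :=
  le_sup_right

lemma sigmaPast_le_sigmaWithout (P : OnlineProblem μ 𝒜 𝒴 𝒰) (t : ℕ) {s i : ℕ} (hs : s ≤ i) :
    P.sigmaPast t s ≤ P.sigmaWithout i := by
  refine sup_le (sup_le (P.sigmaPstar_le_sigmaWithout i)
    (iSup₂_le fun j _ => P.comap_Y_le_sigmaWithout j i)) (iSup₂_le fun j hj => ?_)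
  have hj' : j ≠ i := (lt_of_lt_of_le hj hs).ne
  exact (le_iSup₂ (f := fun (j : ℕ) (_ : j ≠ i) =>
    MeasurableSpace.comap (P.U j) inferInstance) j hj').trans (le_sup_left.trans le_sup_left)

lemma sigmaPast_zero (P : OnlineProblem μ 𝒜 𝒴 𝒰) (t : ℕ) :
    P.sigmaPast t 0 = P.sigmaPstar ⊔ P.sigmaPastY t := by
  simp [sigmaPast]

lemma sigmaPast_succ (P : OnlineProblem μ 𝒜 𝒴 𝒰) (t s : ℕ) :
    P.sigmaPast t (s + 1)
      = P.sigmaPast t s ⊔ MeasurableSpace.comap (P.U s) inferInstance := by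
  have h : Set.Iio (s + 1) = insert s (Set.Iio s) := by ext; simp
  rw [sigmaPast, sigmaPast, h, iSup_insert, sup_comm (MeasurableSpace.comap (P.U s) _), sup_assoc,
    sup_assoc, sup_assoc]

lemma isProbabilityMeasure_pstar (P : OnlineProblem μ 𝒜 𝒴 𝒰) (ω : Ω) :
    IsProbabilityMeasure (P.pstar ω) :=
  P.family_prob _ (P.pstar_mem ω)

lemma measurable_pstar_real (P : OnlineProblem μ 𝒜 𝒴 𝒰) {B : Set (𝒜 → 𝒴)}
    (hB : MeasurableSet B) : Measurable[P.sigmaPstar] fun ω => (P.pstar ω).real B :=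
  (((Measure.measurable_coe hB).comp (comap_measurable P.pstar)).ennreal_toReal :)

lemma integrable_pstar_real [IsProbabilityMeasure μ] (P : OnlineProblem μ 𝒜 𝒴 𝒰) {B : Set (𝒜 → 𝒴)}
    (hB : MeasurableSet B) : Integrable (fun ω => (P.pstar ω).real B) μ := by
  refine Integrable.of_bound (C := 1)
    ((P.measurable_pstar_real hB).mono P.sigmaPstar_le le_rfl).aestronglyMeasurable
    (ae_of_all _ fun ω => ?_)
  have := P.isProbabilityMeasure_pstar ω
  rw [Real.norm_eq_abs, abs_of_nonneg measureReal_nonneg]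
  exact measureReal_le_one

/-- Given `p*` and the earlier outcome vectors, the outcome vector has law `p*`: events. -/
lemma condExp_indicator_Y [IsProbabilityMeasure μ] (P : OnlineProblem μ 𝒜 𝒴 𝒰) (t : ℕ) {B : Set (𝒜 → 𝒴)}
    (hB : MeasurableSet B) :
    (fun ω => (P.pstar ω).real B) =ᵐ[μ]
      μ⟦P.Y t ⁻¹' B | P.sigmaPstar ⊔ P.sigmaPastY t⟧ := by
  classical
  have hYB : MeasurableSet (P.Y t ⁻¹' B) := P.measurable_Y t hB
  have hpm := P.measurable_pstar_real hB
  refine ae_eq_condExp_sup_of_forall_setIntegral_inter_eq P.sigmaPstar_le (P.sigmaPastY_le t)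
    (S₁ := {s | MeasurableSet[P.sigmaPstar] s})
    (@MeasurableSpace.generateFrom_measurableSet Ω P.sigmaPstar).symm
    (generateFrom_piiUnionInter_measurableSet
      (fun s => MeasurableSpace.comap (P.Y s) inferInstance) (Set.Iio t)).symm
    (@MeasurableSpace.isPiSystem_measurableSet Ω P.sigmaPstar)
    (isPiSystem_piiUnionInter _ (fun s => @MeasurableSpace.isPiSystem_measurableSet Ω
      (MeasurableSpace.comap (P.Y s) inferInstance)) _)
    (@MeasurableSet.univ Ω P.sigmaPstar) ⟨∅, by simp, fun _ => Set.univ, by simp, by simp⟩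
    ((integrable_const (1 : ℝ)).indicator hYB) (P.integrable_pstar_real hB)
    (hpm.stronglyMeasurable.mono le_sup_left) ?_
  rintro C hC _ ⟨I, hI, f, hf, rfl⟩
  have hC' : MeasurableSet C := P.sigmaPstar_le _ hC
  choose! B' hB' hfB' using hf
  have hT : (⋂ i ∈ I, f i) = ⋂ i ∈ I, P.Y i ⁻¹' B' i :=
    Set.iInter₂_congr fun i hi => (hfB' i hi).symm
  rw [hT]
  set T : Set Ω := ⋂ i ∈ I, P.Y i ⁻¹' B' i with hTdef
  have hTm : MeasurableSet T :=
    Finset.measurableSet_biInter _ fun i hi => P.measurable_Y i (hB' i hi)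
  have htI : t ∉ I := fun h => lt_irrefl t (hI h)
  have hne : ∀ i ∈ I, i ≠ t := fun i hi h => htI (h ▸ hi)
  -- Comparing the joint law over `I` with that over `insert t I` gains exactly the factor `p*(B)`,
  -- which is a function of `p*` and can be pulled out.
  have hcT := P.cond_iid I B' hB'
  have hcTB := P.cond_iid (insert t I) (Function.update B' t B) (by
    intro i hi
    rcases Finset.mem_insert.1 hi with rfl | hi
    · simpa using hB
    · rw [Function.update_of_ne (hne i hi)]; exact hB' i hi)
  have hset : (⋂ i ∈ insert t I, P.Y i ⁻¹' Function.update B' t B i) = P.Y t ⁻¹' B ∩ T := by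
    rw [Finset.set_biInter_insert, Function.update_self]
    congr 1
    exact Set.iInter₂_congr fun i hi => by rw [Function.update_of_ne (hne i hi)]
  have hprod : ∀ ω, ∏ i ∈ insert t I, (P.pstar ω).real (Function.update B' t B i)
      = (P.pstar ω).real B * ∏ i ∈ I, (P.pstar ω).real (B' i) := by
    intro ω
    rw [Finset.prod_insert htI, Function.update_self]
    congr 1
    exact Finset.prod_congr rfl fun i hi => by rw [Function.update_of_ne (hne i hi)]
  rw [hset] at hcTB
  simp only [hprod] at hcTB
  have hInt : Integrable ((fun ω => (P.pstar ω).real B) * T.indicator fun _ => (1 : ℝ)) μ := by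
    refine ((P.integrable_pstar_real hB).indicator hTm).congr (ae_of_all _ fun ω => ?_)
    by_cases h : ω ∈ T <;> simp [h]
  have hpull := condExp_mul_of_stronglyMeasurable_left (μ := μ) (m := P.sigmaPstar)
    hpm.stronglyMeasurable hInt ((integrable_const (1 : ℝ)).indicator hTm)
  calc ∫ ω in C ∩ T, (P.pstar ω).real B ∂μ
      = ∫ ω in C, ((fun ω => (P.pstar ω).real B) * T.indicator fun _ => (1 : ℝ)) ω ∂μ := by
        rw [← setIntegral_indicator hTm]
        refine setIntegral_congr_fun hC' fun ω _ => ?_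
        by_cases h : ω ∈ T <;> simp [h]
    _ = ∫ ω in C, (P.pstar ω).real B * ∏ i ∈ I, (P.pstar ω).real (B' i) ∂μ := by
        rw [← setIntegral_condExp P.sigmaPstar_le hInt hC]
        refine setIntegral_congr_ae hC' ?_
        filter_upwards [hpull, hcT] with ω h1 h2 _
        rw [h1, Pi.mul_apply, h2]
    _ = ∫ ω in C, (P.Y t ⁻¹' B ∩ T).indicator (fun _ => (1 : ℝ)) ω ∂μ := by
        rw [← setIntegral_condExp P.sigmaPstar_le
          ((integrable_const (1 : ℝ)).indicator (hYB.inter hTm)) hC]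
        refine setIntegral_congr_ae hC' ?_
        filter_upwards [hcTB] with ω h1 _ using h1.symm
    _ = _ := by
        rw [← setIntegral_indicator hTm, Set.indicator_indicator, Set.inter_comm T]

/-- The mean of a function of the outcome vector, under `p*`. -/
lemma stronglyMeasurable_integral_pstar (P : OnlineProblem μ 𝒜 𝒴 𝒰) {h : (𝒜 → 𝒴) → ℝ}
    (hh : Measurable h) : StronglyMeasurable[P.sigmaPstar] fun ω => ∫ y, h y ∂(P.pstar ω) := by
  let κ : @Kernel Ω (𝒜 → 𝒴) P.sigmaPstar _ :=
    @Kernel.mk _ _ P.sigmaPstar _ P.pstar (comap_measurable P.pstar)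
  have : @IsMarkovKernel _ _ P.sigmaPstar _ κ :=
    @IsMarkovKernel.mk _ _ P.sigmaPstar _ κ P.isProbabilityMeasure_pstar
  exact hh.stronglyMeasurable.integral_kernel (κ := κ)

/-- Given `p*` and the earlier outcome vectors, the outcome vector has law `p*`. -/
lemma condExp_comp_Y_sup [IsProbabilityMeasure μ] (P : OnlineProblem μ 𝒜 𝒴 𝒰) (t : ℕ) {h : (𝒜 → 𝒴) → ℝ}
    (hh : Measurable h) {c : ℝ} (hc : ∀ y, ‖h y‖ ≤ c) :
    (fun ω => ∫ y, h y ∂(P.pstar ω)) =ᵐ[μ]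
      μ[fun ω => h (P.Y t ω) | P.sigmaPstar ⊔ P.sigmaPastY t] := by
  have hle : P.sigmaPstar ⊔ P.sigmaPastY t ≤ ‹MeasurableSpace Ω› :=
    sup_le P.sigmaPstar_le (P.sigmaPastY_le t)
  have hsm := P.stronglyMeasurable_integral_pstar hh
  have hbd : ∀ ω, ‖∫ y, h y ∂(P.pstar ω)‖ ≤ c := fun ω => by
    have := P.isProbabilityMeasure_pstar ω
    simpa using norm_integral_le_of_norm_le_const (μ := P.pstar ω) (ae_of_all _ hc)
  refine ae_eq_condExp_of_forall_setIntegral_eq hle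
    (Integrable.of_bound (hh.comp (P.measurable_Y t)).aestronglyMeasurable c
      (ae_of_all _ fun ω => hc _))
    (fun s _ _ => (Integrable.of_bound (hsm.mono P.sigmaPstar_le).aestronglyMeasurable c
      (ae_of_all _ hbd)).integrableOn) (fun S hS _ => ?_)
    (StronglyMeasurable.aestronglyMeasurable
      (hsm.mono (le_sup_left : P.sigmaPstar ≤ P.sigmaPstar ⊔ P.sigmaPastY t)))
  have hS' := hle _ hS
  let κ : Kernel Ω (𝒜 → 𝒴) := ⟨P.pstar, P.measurable_pstar⟩
  have : IsMarkovKernel κ := ⟨P.isProbabilityMeasure_pstar⟩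
  -- Mixing `p*` over `S` gives the law of `Y t` on `S`. As an identity of measures it passes from
  -- events to bounded functions.
  have hmeas : (κ ∘ₖ Kernel.const Unit (μ.restrict S)) () = (μ.restrict S).map (P.Y t) := by
    rw [Kernel.comp_apply, Kernel.const_apply]
    ext B hB
    rw [Measure.bind_apply hB κ.measurable.aemeasurable, Measure.map_apply (P.measurable_Y t) hB]
    have h1 := setIntegral_condExp hle ((integrable_const (μ := μ) (1 : ℝ)).indicator
      (P.measurable_Y t hB)) hS
    rw [← setIntegral_congr_ae hS' ((P.condExp_indicator_Y t hB).mono fun ω hω _ => hω),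
      integral_indicator (P.measurable_Y t hB), setIntegral_const, smul_eq_mul, mul_one] at h1
    have h2 : ∫⁻ ω in S, P.pstar ω B ∂μ = ENNReal.ofReal (∫ ω in S, (P.pstar ω).real B ∂μ) := by
      rw [ofReal_integral_eq_lintegral_ofReal (P.integrable_pstar_real hB).integrableOn
        (ae_of_all _ fun ω => measureReal_nonneg)]
      refine lintegral_congr fun ω => ?_
      have := P.isProbabilityMeasure_pstar ω
      simp
    change ∫⁻ ω in S, P.pstar ω B ∂μ = _
    rw [h2, h1]
    simp
  have hInt : Integrable h ((κ ∘ₖ Kernel.const Unit (μ.restrict S)) ()) :=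
    Integrable.of_bound hh.aestronglyMeasurable c (ae_of_all _ hc)
  have h3 := Kernel.integral_comp hInt
  rw [hmeas, integral_map (P.measurable_Y t).aemeasurable hh.aestronglyMeasurable] at h3
  exact h3.symm

/-- Given `p*`, the earlier outcome vectors and the earlier external randomness, the outcome
vector has law `p*`. -/
lemma condExp_comp_Y_sigmaPast [IsProbabilityMeasure μ] (P : OnlineProblem μ 𝒜 𝒴 𝒰) (t s : ℕ) {h : (𝒜 → 𝒴) → ℝ}
    (hh : Measurable h) {c : ℝ} (hc : ∀ y, ‖h y‖ ≤ c) :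
    (fun ω => ∫ y, h y ∂(P.pstar ω)) =ᵐ[μ] μ[fun ω => h (P.Y t ω) | P.sigmaPast t s] := by
  -- The `U j` are adjoined one at a time, since `indep_U` separates a single `U i` from everything
  -- else.
  induction s with
  | zero =>
    rw [P.sigmaPast_zero]
    exact P.condExp_comp_Y_sup t hh hc
  | succ s ih =>
    rw [P.sigmaPast_succ]
    refine ih.trans (condExp_sup_of_indep (P.sigmaPast_le_sigmaWithout t le_rfl)
      (P.sigmaWithout_le s) (P.measurable_U s).comap_le (P.indep_U s) ?_ ?_).symm
    · exact ((hh.comp (comap_measurable (P.Y t))).stronglyMeasurable).mono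
        (P.comap_Y_le_sigmaWithout t s)
    · exact Integrable.of_bound (hh.comp (P.measurable_Y t)).aestronglyMeasurable c
        (ae_of_all _ fun ω => hc _)

lemma measurable_eval_of_finite [Finite 𝒜] [MeasurableSingletonClass 𝒜] :
    Measurable fun x : 𝒜 × (𝒜 → 𝒴) => x.2 x.1 :=
  measurable_from_prod_countable_right fun a => measurable_pi_apply a

end OnlineProblem

/-! ### Variational lower bound on the negative posterior entropy. -/

section Dual

variable {Ω : Type*} {m G g m₀ : MeasurableSpace Ω} {μ : Measure Ω} [IsProbabilityMeasure μ]

lemma condExp_mem_Icc (hm : m ≤ m₀) {x : Ω → ℝ} (hx : Integrable x μ)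
    (hx01 : ∀ ω, x ω ∈ Set.Icc (0 : ℝ) 1) : ∀ᵐ ω ∂μ, (μ[x | m]) ω ∈ Set.Icc (0 : ℝ) 1 := by
  have h0 : 0 ≤ᵐ[μ] μ[x | m] := condExp_nonneg (ae_of_all _ fun ω => (hx01 ω).1)
  have h1 : μ[x | m] ≤ᵐ[μ] μ[fun _ => (1 : ℝ) | m] :=
    condExp_mono hx (integrable_const _) (ae_of_all _ fun ω => (hx01 ω).2)
  rw [condExp_const hm] at h1
  filter_upwards [h0, h1] with ω h0 h1 using ⟨h0, h1⟩

lemma integrable_of_mem_Icc {x : Ω → ℝ} (hx : Measurable x) (hx01 : ∀ ω, x ω ∈ Set.Icc (0 : ℝ) 1) :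
    Integrable x μ :=
  Integrable.of_mem_Icc 0 1 hx.aemeasurable (ae_of_all _ hx01)

/-- The entropy terms of a posterior probability are integrable. -/
lemma integrable_negMulLog_condExp (hm : m ≤ m₀) {x : Ω → ℝ} (hx : Integrable x μ)
    (hx01 : ∀ ω, x ω ∈ Set.Icc (0 : ℝ) 1) :
    Integrable (fun ω => Real.negMulLog ((μ[x | m]) ω)) μ := by
  refine Integrable.of_mem_Icc 0 1 (Real.continuous_negMulLog.measurable.comp
    (stronglyMeasurable_condExp.mono hm).measurable).aemeasurable ?_
  filter_upwards [condExp_mem_Icc hm hx hx01] with ω hω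
  refine ⟨Real.negMulLog_nonneg hω.1 hω.2, ?_⟩
  have h := mul_sub_exp_le_neg_negMulLog hω.1 1
  simp only [sub_self, Real.exp_zero] at h
  linarith [hω.1]

/-- The variational lower bound on the negative entropy of the posterior probability of an event
(with indicator `x`) after observing which of the `V a` equals one, and then `r a`. -/
lemma sum_dual_le_condExp {ι : Type*} [Fintype ι] (hmG : m ≤ G) (hG : G ≤ m₀) (hg : g ≤ m₀)
    {V r α : ι → Ω → ℝ} {x : Ω → ℝ}
    (hV : ∀ a, StronglyMeasurable[G] (V a)) (hVr : ∀ a, StronglyMeasurable[G] (V a * r a))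
    (hV01 : ∀ ω, ∃ a, V a ω = 1 ∧ ∀ a', a' ≠ a → V a' ω = 0)
    (hrg : ∀ a, StronglyMeasurable[g] (r a)) (hr01 : ∀ a ω, r a ω ∈ Set.Icc (0 : ℝ) 1)
    (hxg : StronglyMeasurable[g] x) (hx01 : ∀ ω, x ω ∈ Set.Icc (0 : ℝ) 1)
    (hcond : ∀ a (W : Ω → ℝ), StronglyMeasurable[g] W → Integrable W μ →
      μ[V a * W | m] =ᵐ[μ] α a * μ[W | m]) (l k : ι → ℝ) :
    ∀ᵐ ω ∂μ, ∑ a, α a ω * (l a * (μ[x * r a | m]) ω - k a * (μ[x | m]) ω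
        - Real.exp (-k a - 1) * (1 + (μ[r a | m]) ω * (Real.exp (l a) - 1)))
      ≤ (μ[fun ω => -Real.negMulLog ((μ[x | G]) ω) | m]) ω := by
  classical
  have hm : m ≤ m₀ := hmG.trans hG
  have hxi : Integrable x μ := integrable_of_mem_Icc (hxg.mono hg).measurable hx01
  have hri : ∀ a, Integrable (r a) μ := fun a =>
    integrable_of_mem_Icc ((hrg a).mono hg).measurable (hr01 a)
  have hxr01 : ∀ a ω, (x * r a) ω ∈ Set.Icc (0 : ℝ) 1 := fun a ω =>
    ⟨mul_nonneg (hx01 ω).1 (hr01 a ω).1, mul_le_one₀ (hx01 ω).2 (hr01 a ω).1 (hr01 a ω).2⟩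
  have hxri : ∀ a, Integrable (x * r a) μ := fun a =>
    integrable_of_mem_Icc ((hxg.mul (hrg a)).mono hg).measurable (hxr01 a)
  have hV01' : ∀ a ω, V a ω ∈ Set.Icc (0 : ℝ) 1 := by
    intro a ω
    obtain ⟨a₀, h1, h0⟩ := hV01 ω
    by_cases h : a = a₀
    · subst h; simp [h1]
    · simp [h0 a h]
  have hVi : ∀ a, Integrable (V a) μ := fun a =>
    integrable_of_mem_Icc ((hV a).mono hG).measurable (hV01' a)
  have hVr01 : ∀ a ω, (V a * r a) ω ∈ Set.Icc (0 : ℝ) 1 := fun a ω =>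
    ⟨mul_nonneg (hV01' a ω).1 (hr01 a ω).1, mul_le_one₀ (hV01' a ω).2 (hr01 a ω).1 (hr01 a ω).2⟩
  have hVri : ∀ a, Integrable (V a * r a) μ := fun a =>
    integrable_of_mem_Icc ((hVr a).mono hG).measurable (hVr01 a)
  -- On `V a = 1` the slope is `l a * r a - k a`. Here `p a` is `V a` times it, and `q a` majorises
  -- `V a * exp (slope - 1)` by the chord of `exp`. The factor `W a` is `g`-measurable, so `hcond`
  -- applies to `V a * W a`.
  let c : ι → ℝ := fun a => Real.exp (-k a - 1)
  let W : ι → Ω → ℝ := fun a => (l a • (x * r a) - k a • x)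
    - c a • ((fun _ => (1 : ℝ)) + (Real.exp (l a) - 1) • r a)
  let p : ι → Ω → ℝ := fun a => l a • (V a * r a) - k a • V a
  let q : ι → Ω → ℝ := fun a => c a • (V a + (Real.exp (l a) - 1) • (V a * r a))
  have hWg : ∀ a, StronglyMeasurable[g] (W a) := fun a =>
    ((((hxg.mul (hrg a)).const_smul _).sub (hxg.const_smul _))).sub
      ((stronglyMeasurable_const.add ((hrg a).const_smul _)).const_smul _)
  have hWi : ∀ a, Integrable (W a) μ := fun a =>
    (((hxri a).smul _).sub (hxi.smul _)).sub (((integrable_const _).add ((hri a).smul _)).smul _)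
  have hpG : ∀ a, StronglyMeasurable[G] (p a) := fun a =>
    ((hVr a).const_smul _).sub ((hV a).const_smul _)
  have hqG : ∀ a, StronglyMeasurable[G] (q a) := fun a =>
    ((hV a).add ((hVr a).const_smul _)).const_smul _
  have hpi : ∀ a, Integrable (p a) μ := fun a => ((hVri a).smul _).sub ((hVi a).smul _)
  have hqi : ∀ a, Integrable (q a) μ := fun a => ((hVi a).add ((hVri a).smul _)).smul _
  have hx1 : ∀ᵐ ω ∂μ, ‖x ω‖ ≤ 1 := ae_of_all _ fun ω => by
    rw [Real.norm_eq_abs, abs_of_nonneg (hx01 ω).1]; exact (hx01 ω).2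
  have hpxi : ∀ a, Integrable (p a * x) μ := fun a => by
    rw [mul_comm]
    exact (hpi a).bdd_mul (hxg.mono hg).aestronglyMeasurable hx1
  have hVW : ∀ a, V a * W a = p a * x - q a := fun a => by
    ext ω
    simp only [W, p, q, Pi.mul_apply, Pi.sub_apply, Pi.add_apply, Pi.smul_apply, smul_eq_mul]
    ring
  have hVWi : ∀ a, Integrable (V a * W a) μ := fun a => by
    rw [hVW]; exact (hpxi a).sub (hqi a)
  have hEG : ∀ a, μ[V a * W a | G] =ᵐ[μ] p a * μ[x | G] - q a := fun a => by
    rw [hVW]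
    have h1 := condExp_sub (hpxi a) (hqi a) G
    have h2 := condExp_mul_of_stronglyMeasurable_left (hpG a) (hpxi a) hxi
    rw [condExp_of_stronglyMeasurable hG (hqG a) (hqi a)] at h1
    filter_upwards [h1, h2] with ω h1 h2
    rw [h1, Pi.sub_apply, Pi.sub_apply, h2]
  have hEm : ∀ a, μ[W a | m] =ᵐ[μ] fun ω => l a * (μ[x * r a | m]) ω - k a * (μ[x | m]) ω
      - c a * (1 + (μ[r a | m]) ω * (Real.exp (l a) - 1)) := fun a => by
    have h1 := condExp_sub (((hxri a).smul (l a)).sub (hxi.smul (k a)))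
      (((integrable_const (1 : ℝ)).add ((hri a).smul (Real.exp (l a) - 1))).smul (c a)) m
    have h2 := condExp_sub ((hxri a).smul (l a)) (hxi.smul (k a)) m
    have h3 := condExp_smul (μ := μ) (l a) (x * r a) m
    have h4 := condExp_smul (μ := μ) (k a) x m
    have h5 := condExp_smul (μ := μ) (c a)
      ((fun _ => (1 : ℝ)) + (Real.exp (l a) - 1) • r a) m
    have h6 := condExp_add (integrable_const (μ := μ) (1 : ℝ))
      ((hri a).smul (Real.exp (l a) - 1)) m
    have h7 := condExp_smul (μ := μ) (Real.exp (l a) - 1) (r a) m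
    rw [condExp_const hm] at h6
    filter_upwards [h1, h2, h3, h4, h5, h6, h7] with ω h1 h2 h3 h4 h5 h6 h7
    refine h1.trans ?_
    simp only [Pi.sub_apply, h2, h3, h4, h5, Pi.smul_apply, h6, Pi.add_apply, h7, smul_eq_mul]
    ring
  have hle : (fun ω => ∑ a, (μ[V a * W a | G]) ω) ≤ᵐ[μ]
      fun ω => -Real.negMulLog ((μ[x | G]) ω) := by
    -- Only one `V a` is nonzero, so the sum is the affine minorant selected by the observation,
    -- evaluated at the posterior probability.
    filter_upwards [ae_all_iff.2 hEG, condExp_mem_Icc hG hxi hx01] with ω h1 h2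
    obtain ⟨a, ha1, ha0⟩ := hV01 ω
    rw [Finset.sum_eq_single a]
    · rw [h1 a]
      have h3 := mul_sub_exp_le_neg_negMulLog h2.1 (l a * r a ω - k a)
      have h4 := mul_le_mul_of_nonneg_left (exp_mul_le_one_add (hr01 a ω).1 (hr01 a ω).2 (l a))
        (Real.exp_nonneg (-k a - 1))
      rw [← Real.exp_add] at h4
      have h5 : -k a - 1 + l a * r a ω = l a * r a ω - k a - 1 := by ring
      rw [h5] at h4
      simp only [p, q, c, Pi.mul_apply, Pi.sub_apply, Pi.add_apply, Pi.smul_apply, smul_eq_mul, ha1]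
      linarith
    · intro a' _ hne
      rw [h1 a']
      simp [p, q, ha0 a' hne]
    · simp
  have hmono := condExp_mono (m := m) (integrable_finsetSum Finset.univ
    fun a _ => integrable_condExp (μ := μ) (m := G) (f := V a * W a))
    (integrable_negMulLog_condExp hG hxi hx01).neg hle
  have hsum := condExp_finsetSum (s := Finset.univ)
    (fun a _ => integrable_condExp (μ := μ) (m := G) (f := V a * W a)) m
  have htower : ∀ a, μ[μ[V a * W a | G] | m] =ᵐ[μ] μ[V a * W a | m] := fun a =>
    condExp_condExp_of_le hmG hG
  have hsum' : (fun ω => ∑ a, (μ[V a * W a | G]) ω) = ∑ a, μ[V a * W a | G] := by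
    ext ω; simp
  rw [hsum'] at hmono
  filter_upwards [hmono, hsum, ae_all_iff.2 htower, ae_all_iff.2 hEm,
    ae_all_iff.2 fun a => hcond a (W a) (hWg a) (hWi a)] with ω h1 h2 h3 h4 h5
  refine le_trans (le_of_eq ?_) h1
  rw [h2, Finset.sum_apply]
  refine Finset.sum_congr rfl fun a _ => ?_
  rw [h3 a, h5 a, Pi.mul_apply, h4 a]

/-- The bound of `sum_dual_le_condExp`, simultaneously for all parameters. -/
lemma forall_sum_dual_le_condExp {ι : Type*} [Fintype ι] (hmG : m ≤ G) (hG : G ≤ m₀) (hg : g ≤ m₀)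
    {V r α : ι → Ω → ℝ} {x : Ω → ℝ}
    (hV : ∀ a, StronglyMeasurable[G] (V a)) (hVr : ∀ a, StronglyMeasurable[G] (V a * r a))
    (hV01 : ∀ ω, ∃ a, V a ω = 1 ∧ ∀ a', a' ≠ a → V a' ω = 0)
    (hrg : ∀ a, StronglyMeasurable[g] (r a)) (hr01 : ∀ a ω, r a ω ∈ Set.Icc (0 : ℝ) 1)
    (hxg : StronglyMeasurable[g] x) (hx01 : ∀ ω, x ω ∈ Set.Icc (0 : ℝ) 1)
    (hcond : ∀ a (W : Ω → ℝ), StronglyMeasurable[g] W → Integrable W μ →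
      μ[V a * W | m] =ᵐ[μ] α a * μ[W | m]) :
    ∀ᵐ ω ∂μ, ∀ l k : ι → ℝ, ∑ a, α a ω * (l a * (μ[x * r a | m]) ω - k a * (μ[x | m]) ω
        - Real.exp (-k a - 1) * (1 + (μ[r a | m]) ω * (Real.exp (l a) - 1)))
      ≤ (μ[fun ω => -Real.negMulLog ((μ[x | G]) ω) | m]) ω := by
  -- The parameters used later depend on `ω`, so one null set must serve all of them: a countable
  -- dense set and continuity suffice.
  have h := ae_all_iff.2 fun n : ℕ =>
    sum_dual_le_condExp hmG hG hg hV hVr hV01 hrg hr01 hxg hx01 hcond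
      (TopologicalSpace.denseSeq ((ι → ℝ) × (ι → ℝ)) n).1
      (TopologicalSpace.denseSeq ((ι → ℝ) × (ι → ℝ)) n).2
  filter_upwards [h] with ω hω l k
  have hcl : IsClosed {z : (ι → ℝ) × (ι → ℝ) | ∑ a, α a ω * (z.1 a * (μ[x * r a | m]) ω
      - z.2 a * (μ[x | m]) ω
      - Real.exp (-z.2 a - 1) * (1 + (μ[r a | m]) ω * (Real.exp (z.1 a) - 1)))
      ≤ (μ[fun ω => -Real.negMulLog ((μ[x | G]) ω) | m]) ω} :=
    isClosed_le (by fun_prop) continuous_const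
  have hall := (TopologicalSpace.denseRange_denseSeq ((ι → ℝ) × (ι → ℝ))).induction_on
    (p := fun z => ∑ a, α a ω * (z.1 a * (μ[x * r a | m]) ω - z.2 a * (μ[x | m]) ω
      - Real.exp (-z.2 a - 1) * (1 + (μ[r a | m]) ω * (Real.exp (z.1 a) - 1)))
      ≤ (μ[fun ω => -Real.negMulLog ((μ[x | G]) ω) | m]) ω) (l, k) hcl hω
  exact hall

end Dual

/-- Coordinatewise conditional expectation preserves membership in a linear subspace. -/
lemma condExp_mem_submodule {Ω ι : Type*} [Fintype ι] {m m₀ : MeasurableSpace Ω} {μ : Measure Ω}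
    (L : Submodule ℝ (ι → ℝ)) {f : ι → Ω → ℝ} (hf : ∀ a, Integrable (f a) μ)
    (hL : ∀ ω, (fun a => f a ω) ∈ L) : ∀ᵐ ω ∂μ, (fun a => (μ[f a | m]) ω) ∈ L := by
  classical
  -- Membership in `L` becomes invariance under a projection onto `L`, that is, finitely many linear
  -- identities between coordinates.
  obtain ⟨Q, hQ⟩ := LinearMap.exists_leftInverse_of_injective L.subtype L.ker_subtype
  let q : ι → ι → ℝ := fun a a' => (Q (fun j => if a' = j then 1 else 0) : ι → ℝ) a
  have hQv : ∀ (v : ι → ℝ) (a : ι), (Q v : ι → ℝ) a = ∑ a', q a a' * v a' := by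
    intro v a
    conv_lhs => rw [LinearMap.pi_apply_eq_sum_univ Q v]
    simp [q, Finset.sum_apply, mul_comm]
  have hfq : ∀ a, f a = ∑ a', q a a' • f a' := by
    intro a
    ext ω
    have h1 : Q (fun a => f a ω) = ⟨_, hL ω⟩ := LinearMap.congr_fun hQ ⟨_, hL ω⟩
    have h2 := hQv (fun a => f a ω) a
    rw [h1] at h2
    simpa using h2
  have hE : ∀ a, μ[f a | m] =ᵐ[μ] ∑ a', μ[q a a' • f a' | m] := fun a => by
    conv_lhs => rw [hfq a]
    exact condExp_finsetSum (fun a' _ => (hf a').smul _) m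
  have hS : ∀ a a', μ[q a a' • f a' | m] =ᵐ[μ] q a a' • μ[f a' | m] := fun a a' =>
    condExp_smul _ _ _
  filter_upwards [ae_all_iff.2 hE, ae_all_iff.2 fun a => ae_all_iff.2 (hS a)] with ω h1 h2
  have h3 : (fun a => (μ[f a | m]) ω) = (Q (fun a => (μ[f a | m]) ω) : ι → ℝ) := by
    ext a
    rw [hQv, h1 a, Finset.sum_apply]
    exact Finset.sum_congr rfl fun a' _ => by simp [h2 a a']
  rw [h3]
  exact Submodule.coe_mem _

lemma sum_indicator_preimage_mul {Ω ι : Type*} [Fintype ι] {X : Ω → ι} (f : ι → Ω → ℝ) (ω : Ω) :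
    ∑ a, (X ⁻¹' {a}).indicator (fun _ => (1 : ℝ)) ω * f a ω = f (X ω) ω := by
  classical
  rw [Finset.sum_eq_single (X ω)]
  · simp
  · intro b _ hb
    have h : ω ∉ X ⁻¹' {b} := fun h => hb (Eq.symm h)
    rw [Set.indicator_of_notMem h, zero_mul]
  · simp

lemma indicator_one_mem_Icc {Ω : Type*} (s : Set Ω) (ω : Ω) :
    s.indicator (fun _ => (1 : ℝ)) ω ∈ Set.Icc (0 : ℝ) 1 := by
  by_cases h : ω ∈ s <;> simp [h]

/-! ### The one-period bound for Thompson sampling. -/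

namespace OnlineProblem

variable {Ω : Type*} [MeasurableSpace Ω] {μ : Measure Ω}
  {𝒜 𝒴 𝒰 : Type*} [MeasurableSpace 𝒜] [MeasurableSpace 𝒴] [MeasurableSpace 𝒰]

lemma sigmaPast_mono (P : OnlineProblem μ 𝒜 𝒴 𝒰) {t t' s s' : ℕ} (ht : t ≤ t') (hs : s ≤ s') :
    P.sigmaPast t s ≤ P.sigmaPast t' s' :=
  sup_le_sup (sup_le_sup le_rfl (biSup_mono fun _ hi => lt_of_lt_of_le hi ht))
    (biSup_mono fun _ hi => lt_of_lt_of_le hi hs)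

lemma comap_Y_le_sigmaPast (P : OnlineProblem μ 𝒜 𝒴 𝒰) {i t : ℕ} (hi : i < t) (s : ℕ) :
    MeasurableSpace.comap (P.Y i) inferInstance ≤ P.sigmaPast t s :=
  (le_iSup₂ (f := fun (j : ℕ) (_ : j ∈ Set.Iio t) =>
    MeasurableSpace.comap (P.Y j) inferInstance) i hi).trans (le_sup_right.trans le_sup_left)

lemma comap_U_le_sigmaPast (P : OnlineProblem μ 𝒜 𝒴 𝒰) {i s : ℕ} (hi : i < s) (t : ℕ) :
    MeasurableSpace.comap (P.U i) inferInstance ≤ P.sigmaPast t s :=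
  (le_iSup₂ (f := fun (j : ℕ) (_ : j ∈ Set.Iio s) =>
    MeasurableSpace.comap (P.U j) inferInstance) i hi).trans le_sup_right

lemma hist_succ (P : OnlineProblem μ 𝒜 𝒴 𝒰) (t : ℕ) :
    P.hist (t + 1) = P.hist t ⊔
      MeasurableSpace.comap (fun ω => (P.A t ω, P.Y t ω (P.A t ω))) inferInstance := by
  simp only [hist, history]
  exact Nat.iSup_lt_succ _ _

/-- Regret sees only reward differences, so rewards may be shifted into `[0, 1]`, where the scalar
inequalities apply. -/
lemma exists_forall_sub_mem_Icc (P : OnlineProblem μ 𝒜 𝒴 𝒰) (hR : P.RewardRangeLeOne) :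
    ∃ c : ℝ, ∀ y, P.R y - c ∈ Set.Icc (0 : ℝ) 1 := by
  refine ⟨sInf (Set.range P.R), fun y => ?_⟩
  have hbdd : BddBelow (Set.range P.R) := ⟨P.R y - 1, by
    rintro _ ⟨y', rfl⟩
    linarith [hR y y']⟩
  have h1 := csInf_le hbdd ⟨y, rfl⟩
  have h2 : P.R y - 1 ≤ sInf (Set.range P.R) := le_csInf ⟨_, y, rfl⟩ (by
    rintro _ ⟨y', rfl⟩
    linarith [hR y y'])
  constructor <;> linarith

lemma measurableSet_Astar_preimage [MeasurableSingletonClass 𝒜] (P : OnlineProblem μ 𝒜 𝒴 𝒰) (b : 𝒜) :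
    MeasurableSet (P.Astar ⁻¹' {b}) :=
  P.sigmaPstar_le _ (P.measurable_Astar (measurableSet_singleton b))

/-- Adjoining the observation to one history gives the next, so the gain is an expected drop in
posterior entropy, ready to telescope. -/
lemma infoGain_eq [Fintype 𝒜] (P : OnlineProblem μ 𝒜 𝒴 𝒰) (t : ℕ) :
    P.infoGain t = postEntropy (P.hist t) μ P.Astar
      - μ[postEntropy (P.hist (t + 1)) μ P.Astar | P.hist t] := by
  ext ω
  rw [infoGain, postMutualInfo, postCondEntropy, ← P.hist_succ]
  rfl

section Fintype

variable [Fintype 𝒜] [MeasurableSingletonClass 𝒜]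

lemma measurable_observation {A : Ω → 𝒜} {Y : Ω → 𝒜 → 𝒴} (hA : Measurable A)
    (hY : Measurable Y) : Measurable fun ω => (A ω, Y ω (A ω)) :=
  hA.prodMk (measurable_eval_of_finite.comp (hA.prodMk hY))

/-- Each past action is a function of its own history and `U s`, so by strong induction only
randomness from before period `t` enters. -/
lemma hist_le_sigmaPast (P : OnlineProblem μ 𝒜 𝒴 𝒰) (t : ℕ) : P.hist t ≤ P.sigmaPast t t := by
  induction t using Nat.strong_induction_on with
  | _ t ih =>
    refine iSup₂_le fun s hs => Measurable.comap_le ?_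
    refine @measurable_observation _ (P.sigmaPast t t) _ _ _ _ _ _ _ _ ?_ ?_
    · exact (P.measurable_A s).mono (sup_le ((ih s hs).trans (P.sigmaPast_mono hs.le hs.le))
        (P.comap_U_le_sigmaPast hs t)) le_rfl
    · exact (comap_measurable (P.Y s)).mono (P.comap_Y_le_sigmaPast hs t) le_rfl

lemma hist_le_sigmaWithout (P : OnlineProblem μ 𝒜 𝒴 𝒰) (t : ℕ) : P.hist t ≤ P.sigmaWithout t :=
  (P.hist_le_sigmaPast t).trans (P.sigmaPast_le_sigmaWithout t le_rfl)

lemma hist_le (P : OnlineProblem μ 𝒜 𝒴 𝒰) (t : ℕ) : P.hist t ≤ ‹MeasurableSpace Ω› :=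
  (P.hist_le_sigmaWithout t).trans (P.sigmaWithout_le t)

lemma infoGain_ae_eq [IsProbabilityMeasure μ] (P : OnlineProblem μ 𝒜 𝒴 𝒰) (t : ℕ) :
    P.infoGain t =ᵐ[μ] fun ω => ∑ b,
      ((μ[fun ω => -Real.negMulLog ((μ⟦P.Astar ⁻¹' {b} | P.hist (t + 1)⟧) ω) | P.hist t]) ω
        + Real.negMulLog ((μ⟦P.Astar ⁻¹' {b} | P.hist t⟧) ω)) := by
  have hi : ∀ b, Integrable
      (fun ω => Real.negMulLog ((μ⟦P.Astar ⁻¹' {b} | P.hist (t + 1)⟧) ω)) μ := fun b =>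
    integrable_negMulLog_condExp (P.hist_le _) ((integrable_const (1 : ℝ)).indicator
      (P.measurableSet_Astar_preimage b))
      (indicator_one_mem_Icc _)
  have h1 := condExp_finsetSum (s := Finset.univ) (fun b _ => hi b) (P.hist t)
  have h2 := ae_all_iff.2 fun b => condExp_neg (μ := μ)
    (fun ω => Real.negMulLog ((μ⟦P.Astar ⁻¹' {b} | P.hist (t + 1)⟧) ω)) (P.hist t)
  filter_upwards [h1, h2] with ω h1 h2
  have h3 : postEntropy (P.hist (t + 1)) μ P.Astar
      = ∑ b, fun ω => Real.negMulLog ((μ⟦P.Astar ⁻¹' {b} | P.hist (t + 1)⟧) ω) := by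
    ext ω; simp [postEntropy]
  rw [P.infoGain_eq, Pi.sub_apply, h3, h1, postEntropy,
    Finset.sum_add_distrib, Finset.sum_apply, sub_eq_add_neg, ← Finset.sum_neg_distrib, add_comm]
  refine congrArg (· + _) ?_
  exact Finset.sum_congr rfl fun b _ => (h2 b).symm

/-- If the mean rewards of all models lie in a `d`-dimensional space, then the squared expected
regret of Thompson sampling is at most `d / 2` times the information gain. -/
lemma sq_condExp_regretAt_le [IsProbabilityMeasure μ] (P : OnlineProblem μ 𝒜 𝒴 𝒰)
    (hR : P.RewardRangeLeOne) (hTS : P.IsThompson) {d : ℕ} (L : Submodule ℝ (𝒜 → ℝ))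
    (hL : Module.finrank ℝ L ≤ d)
    (hlin : ∀ p ∈ P.family, (fun a => ∫ y, P.R y ∂(marginal p a)) ∈ L) (t : ℕ) :
    ∀ᵐ ω ∂μ, (μ[P.regretAt t | P.hist t]) ω ^ 2 ≤ d / 2 * P.infoGain t ω := by
  classical
  obtain ⟨c, hc⟩ := P.exists_forall_sub_mem_Icc hR
  have hm := P.hist_le t
  have hmg := P.hist_le_sigmaWithout t
  have hg := P.sigmaWithout_le t
  let x : 𝒜 → Ω → ℝ := fun b => (P.Astar ⁻¹' {b}).indicator fun _ => 1
  let V : 𝒜 → Ω → ℝ := fun a => (P.A t ⁻¹' {a}).indicator fun _ => 1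
  let r : 𝒜 → Ω → ℝ := fun a ω => P.R (P.Y t ω a) - c
  have hrfun : ∀ a, Measurable fun y : 𝒜 → 𝒴 => P.R (y a) - c := fun a =>
    (P.measurable_R.comp (measurable_pi_apply a)).sub_const c
  have hbd : ∀ a (y : 𝒜 → 𝒴), ‖P.R (y a) - c‖ ≤ 1 := fun a y => by
    rw [Real.norm_eq_abs, abs_of_nonneg (hc _).1]; exact (hc _).2
  have hr01 : ∀ a ω, r a ω ∈ Set.Icc (0 : ℝ) 1 := fun a ω => hc _
  have hrg : ∀ a, StronglyMeasurable[P.sigmaWithout t] (r a) := fun a =>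
    ((hrfun a).comp (comap_measurable (P.Y t))).stronglyMeasurable.mono
      (P.comap_Y_le_sigmaWithout t t)
  have hx01 : ∀ b ω, x b ω ∈ Set.Icc (0 : ℝ) 1 := fun b => indicator_one_mem_Icc _
  have hxp : ∀ b, StronglyMeasurable[P.sigmaPstar] (x b) := fun b =>
    stronglyMeasurable_const.indicator (P.measurable_Astar (measurableSet_singleton b))
  have hxg : ∀ b, StronglyMeasurable[P.sigmaWithout t] (x b) := fun b =>
    (hxp b).mono (P.sigmaPstar_le_sigmaWithout t)
  have hxi : ∀ b, Integrable (x b) μ := fun b =>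
    integrable_of_mem_Icc ((hxg b).mono hg).measurable (hx01 b)
  have hri : ∀ a, Integrable (r a) μ := fun a =>
    integrable_of_mem_Icc ((hrg a).mono hg).measurable (hr01 a)
  have hxr01 : ∀ a b ω, (x b * r a) ω ∈ Set.Icc (0 : ℝ) 1 := fun a b ω =>
    ⟨mul_nonneg (hx01 b ω).1 (hr01 a ω).1, mul_le_one₀ (hx01 b ω).2 (hr01 a ω).1 (hr01 a ω).2⟩
  have hxri : ∀ a b, Integrable (x b * r a) μ := fun a b =>
    integrable_of_mem_Icc (((hxg b).mul (hrg a)).mono hg).measurable (hxr01 a b)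
  have hmu : P.hist t ⊔ MeasurableSpace.comap (P.U t) inferInstance ≤ ‹MeasurableSpace Ω› :=
    sup_le hm (P.measurable_U t).comap_le
  have hVmu : ∀ a, StronglyMeasurable[P.hist t ⊔ MeasurableSpace.comap (P.U t) inferInstance] (V a) :=
    fun a => stronglyMeasurable_const.indicator (P.measurable_A t (measurableSet_singleton a))
  have hVbd : ∀ a ω, ‖V a ω‖ ≤ 1 := fun a ω => by
    have h := indicator_one_mem_Icc (P.A t ⁻¹' {a}) ω
    rw [Real.norm_eq_abs, abs_of_nonneg h.1]; exact h.2
  have hVri : ∀ a, Integrable (V a * r a) μ := fun a =>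
    (hri a).bdd_mul ((hVmu a).mono hmu).aestronglyMeasurable (ae_of_all _ (hVbd a))
  -- Given the history, the action depends only on `U t`, hence decouples from `W`; Thompson
  -- sampling identifies its law with the posterior of `Astar`.
  have hcond : ∀ a (W : Ω → ℝ), StronglyMeasurable[P.sigmaWithout t] W → Integrable W μ →
      μ[V a * W | P.hist t] =ᵐ[μ] μ[x a | P.hist t] * μ[W | P.hist t] := by
    intro a W hW hWi
    refine (condExp_mul_of_indep hmg hg (P.measurable_U t).comap_le (P.indep_U t) hW hWi
      (hVmu a) (hVbd a)).trans ?_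
    filter_upwards [hTS t a] with ω hω
    simp only [Pi.mul_apply]
    congr 1
  -- the observation is measurable with respect to the next history
  have hZ : Measurable[P.hist (t + 1)] fun ω => (P.A t ω, P.Y t ω (P.A t ω)) := by
    rw [P.hist_succ]
    exact (comap_measurable _).mono le_sup_right le_rfl
  have hmG : P.hist t ≤ P.hist (t + 1) := by
    rw [P.hist_succ]; exact le_sup_left
  have hVG : ∀ a, StronglyMeasurable[P.hist (t + 1)] (V a) := fun a =>
    stronglyMeasurable_const.indicator ((measurable_fst.comp hZ) (measurableSet_singleton a))
  have hVrG : ∀ a, StronglyMeasurable[P.hist (t + 1)] (V a * r a) := fun a => by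
    -- Where `V a` is nonzero, the reward of `a` is the observed one.
    have h1 : V a * r a = V a * fun ω => P.R (P.Y t ω (P.A t ω)) - c := by
      ext ω
      by_cases h : P.A t ω = a
      · simp [V, r, h]
      · have h0 : V a ω = 0 := Set.indicator_of_notMem (s := P.A t ⁻¹' {a}) h _
        simp [h0]
    rw [h1]
    exact (hVG a).mul
      ((P.measurable_R.comp (measurable_snd.comp hZ)).sub_const c).stronglyMeasurable
  have hV01 : ∀ ω, ∃ a, V a ω = 1 ∧ ∀ a', a' ≠ a → V a' ω = 0 := fun ω =>
    ⟨P.A t ω, by simp [V], fun a' ha' =>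
      Set.indicator_of_notMem (s := P.A t ⁻¹' {a'}) (fun h => ha' (Eq.symm h)) _⟩
  have hdual := ae_all_iff.2 fun b => forall_sum_dual_le_condExp hmG (P.hist_le (t + 1)) hg
    hVG hVrG hV01 hrg hr01 (hxg b) (hx01 b) hcond
  -- the conditional mean rewards in terms of the mean rewards under `p*`
  let ρ : 𝒜 → Ω → ℝ := fun a ω => ∫ y, P.R y ∂(marginal (P.pstar ω) a)
  have hρ : ∀ a ω, ∫ y, (P.R (y a) - c) ∂(P.pstar ω) = ρ a ω - c := by
    intro a ω
    have := P.isProbabilityMeasure_pstar ω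
    have hRi : Integrable (fun y : 𝒜 → 𝒴 => P.R (y a)) (P.pstar ω) := by
      have h := (Integrable.of_bound (μ := P.pstar ω) (hrfun a).aestronglyMeasurable 1
        (ae_of_all _ (hbd a))).add (integrable_const c)
      refine h.congr (ae_of_all _ fun y => ?_)
      simp
    rw [integral_sub hRi (integrable_const c)]
    simp only [ρ, marginal]
    rw [integral_map (measurable_pi_apply a).aemeasurable P.measurable_R.aestronglyMeasurable]
    simp
  have hρp : ∀ a, StronglyMeasurable[P.sigmaPstar] (ρ a) := fun a => by
    have h := (P.stronglyMeasurable_integral_pstar (hrfun a)).add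
      (stronglyMeasurable_const (b := c))
    convert h using 1
    ext ω
    simp [hρ]
  have hKle : P.sigmaPast t t ≤ ‹MeasurableSpace Ω› :=
    (P.sigmaPast_le_sigmaWithout t le_rfl).trans hg
  have hpK : P.sigmaPstar ≤ P.sigmaPast t t := le_sup_left.trans le_sup_left
  have hrK : ∀ a, μ[r a | P.sigmaPast t t] =ᵐ[μ] fun ω => ρ a ω - c := fun a => by
    refine (P.condExp_comp_Y_sigmaPast t t (hrfun a) (hbd a)).symm.trans (ae_of_all _ fun ω => ?_)
    exact hρ a ω
  have hρi : ∀ a, Integrable (ρ a) μ := fun a => by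
    have h := ((integrable_condExp (μ := μ) (m := P.sigmaPast t t) (f := r a)).congr
      (hrK a)).add (integrable_const c)
    refine h.congr (ae_of_all _ fun ω => ?_)
    simp
  have hx1 : ∀ b, ∀ᵐ ω ∂μ, ‖x b ω‖ ≤ 1 := fun b => ae_of_all _ fun ω => by
    rw [Real.norm_eq_abs, abs_of_nonneg (hx01 b ω).1]; exact (hx01 b ω).2
  have hxρi : ∀ a b, Integrable (x b * ρ a) μ := fun a b =>
    (hρi a).bdd_mul ((hxg b).mono hg).aestronglyMeasurable (hx1 b)
  have hμr : ∀ a, μ[r a | P.hist t] =ᵐ[μ] fun ω => (μ[ρ a | P.hist t]) ω - c := fun a => by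
    have h1 : μ[μ[r a | P.sigmaPast t t] | P.hist t] =ᵐ[μ] μ[r a | P.hist t] :=
      condExp_condExp_of_le (P.hist_le_sigmaPast t) hKle
    have h2 : μ[ρ a - fun _ => c | P.hist t] =ᵐ[μ] μ[ρ a | P.hist t] - μ[fun _ => c | P.hist t] :=
      condExp_sub (hρi a) (integrable_const c) (P.hist t)
    rw [condExp_const hm] at h2
    exact h1.symm.trans ((condExp_congr_ae (hrK a)).trans h2)
  have hMr : ∀ a b, μ[x b * r a | P.hist t] =ᵐ[μ]
      fun ω => (μ[x b * ρ a | P.hist t]) ω - c * (μ[x b | P.hist t]) ω := fun a b => by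
    have h1 : μ[μ[x b * r a | P.sigmaPast t t] | P.hist t] =ᵐ[μ] μ[x b * r a | P.hist t] :=
      condExp_condExp_of_le (P.hist_le_sigmaPast t) hKle
    -- `Astar` is a function of `p*`, so `x b` comes out and the realised reward is replaced by its
    -- mean under `p*`, where linearity is available.
    have h2 : μ[x b * r a | P.sigmaPast t t] =ᵐ[μ] x b * ρ a - c • x b := by
      refine (condExp_mul_of_stronglyMeasurable_left ((hxp b).mono hpK) (hxri a b)
        (hri a)).trans ?_
      filter_upwards [hrK a] with ω hω
      simp only [Pi.mul_apply, Pi.sub_apply, Pi.smul_apply, smul_eq_mul, hω]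
      ring
    have h3 := condExp_sub (hxρi a b) ((hxi b).smul c) (P.hist t)
    have h4 := condExp_smul (μ := μ) c (x b) (P.hist t)
    refine h1.symm.trans ((condExp_congr_ae h2).trans (h3.trans ?_))
    filter_upwards [h4] with ω h4
    simp [h4]
  have hρL : ∀ ω, (fun a => ρ a ω) ∈ L := fun ω => hlin _ (P.pstar_mem ω)
  have hmem1 := condExp_mem_submodule (m := P.hist t) L hρi hρL
  have hmem2 := ae_all_iff.2 fun b => condExp_mem_submodule (m := P.hist t) L (fun a => hxρi a b)
    (fun ω => L.smul_mem (x b ω) (hρL ω))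
  -- the expected regret
  have hreg : μ[P.regretAt t | P.hist t] =ᵐ[μ]
      fun ω => ∑ a, ((μ[x a * r a | P.hist t]) ω - (μ[x a | P.hist t]) ω * (μ[r a | P.hist t]) ω) := by
    have h0 : P.regretAt t = ∑ a, (x a * r a - V a * r a) := by
      ext ω
      rw [Finset.sum_apply]
      simp only [Pi.sub_apply, Pi.mul_apply, Finset.sum_sub_distrib]
      rw [sum_indicator_preimage_mul, sum_indicator_preimage_mul]
      simp [regretAt, r]
    rw [h0]
    have h1 := condExp_finsetSum (s := Finset.univ)
      (fun a _ => (hxri a a).sub (hVri a)) (P.hist t)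
    have h2 := ae_all_iff.2 fun a => condExp_sub (hxri a a) (hVri a) (P.hist t)
    filter_upwards [h1, h2, ae_all_iff.2 fun a => hcond a (r a) (hrg a) (hri a)] with ω h1 h2 h3
    rw [h1, Finset.sum_apply]
    refine Finset.sum_congr rfl fun a _ => ?_
    rw [h2 a, Pi.sub_apply, h3 a, Pi.mul_apply]
  have hsum : ∀ᵐ ω ∂μ, ∑ a, (μ[x a | P.hist t]) ω = 1 := by
    have h0 : ∑ a, x a = fun _ => (1 : ℝ) := by
      ext ω
      have := sum_indicator_preimage_mul (X := P.Astar) (fun _ _ => 1) ω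
      simpa [x] using this
    have h1 := condExp_finsetSum (s := Finset.univ) (fun a _ => hxi a) (P.hist t)
    rw [h0, condExp_const hm] at h1
    filter_upwards [h1] with ω h1
    simpa using h1.symm
  have hM1 : ∀ a b, μ[x b * r a | P.hist t] ≤ᵐ[μ] μ[x b | P.hist t] := fun a b =>
    condExp_mono (hxri a b) (hxi b) (ae_of_all _ fun ω =>
      mul_le_of_le_one_right (hx01 b ω).1 (hr01 a ω).2)
  filter_upwards [hreg, hdual, hsum, hmem1, hmem2, P.infoGain_ae_eq t,
    ae_all_iff.2 fun a => condExp_mem_Icc hm (hxi a) (hx01 a),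
    ae_all_iff.2 fun a => condExp_mem_Icc hm (hri a) (hr01 a),
    ae_all_iff.2 fun a => ae_all_iff.2 fun b => condExp_mem_Icc hm (hxri a b) (hxr01 a b),
    ae_all_iff.2 fun a => ae_all_iff.2 (hM1 a), ae_all_iff.2 hμr,
    ae_all_iff.2 fun a => ae_all_iff.2 (hMr a)]
    with ω hreg hdual hsum hmem1 hmem2 hinfo hα hr hM0 hM1 hμr hMr
  rw [hreg, hinfo]
  refine sq_sum_le_of_forall_dual L hL (fun a => (μ[x a | P.hist t]) ω) (fun a => (μ[r a | P.hist t]) ω)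
    (fun b => (μ[fun ω => -Real.negMulLog ((μ[x b | P.hist (t + 1)]) ω) | P.hist t]) ω)
    (fun a b => (μ[x b * r a | P.hist t]) ω) (fun a => (hα a).1) hsum (fun a => (hr a).1)
    (fun a => (hr a).2) (fun a b => (hM0 a b).1) hM1 (fun b => ?_) hdual
  -- The shift `c` cancels in the covariance, so `L` need not contain the constants.
  have h := L.sub_mem (hmem2 b) (L.smul_mem ((μ[x b | P.hist t]) ω) hmem1)
  convert h using 1
  ext a
  simp only [hμr a, hMr a b, Pi.sub_apply, Pi.smul_apply, smul_eq_mul]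
  ring

end Fintype

end OnlineProblem

/-! ### From information gain to cumulative regret. -/

namespace OnlineProblem

variable {Ω : Type*} [MeasurableSpace Ω] {μ : Measure Ω} [IsProbabilityMeasure μ]
  {𝒜 𝒴 𝒰 : Type*} [MeasurableSpace 𝒜] [MeasurableSpace 𝒴] [MeasurableSpace 𝒰]
  [Fintype 𝒜] [MeasurableSingletonClass 𝒜]

lemma integrable_postEntropy (P : OnlineProblem μ 𝒜 𝒴 𝒰) (t : ℕ) :
    Integrable (postEntropy (P.hist t) μ P.Astar) μ :=
  integrable_finsetSum _ fun b _ => integrable_negMulLog_condExp (P.hist_le t)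
    ((integrable_const (1 : ℝ)).indicator (P.measurableSet_Astar_preimage b))
    (indicator_one_mem_Icc _)

lemma integrable_infoGain (P : OnlineProblem μ 𝒜 𝒴 𝒰) (t : ℕ) : Integrable (P.infoGain t) μ := by
  rw [P.infoGain_eq]
  exact (P.integrable_postEntropy t).sub integrable_condExp

lemma integral_infoGain (P : OnlineProblem μ 𝒜 𝒴 𝒰) (t : ℕ) :
    ∫ ω, P.infoGain t ω ∂μ = ∫ ω, postEntropy (P.hist t) μ P.Astar ω ∂μ
      - ∫ ω, postEntropy (P.hist (t + 1)) μ P.Astar ω ∂μ := by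
  rw [P.infoGain_eq, integral_sub' (P.integrable_postEntropy t) integrable_condExp,
    integral_condExp (P.hist_le t)]

/-- The total expected information gain is at most the entropy of the optimal action. -/
lemma sum_integral_infoGain_le (P : OnlineProblem μ 𝒜 𝒴 𝒰) (T : ℕ) :
    ∑ t ∈ Finset.range T, ∫ ω, P.infoGain t ω ∂μ ≤ entropy μ P.Astar := by
  simp only [P.integral_infoGain]
  rw [Finset.sum_range_sub']
  -- The initial history is trivial, so the telescoping sum starts at the prior entropy; its last
  -- term is nonnegative.
  have h0 : ∫ ω, postEntropy (P.hist 0) μ P.Astar ω ∂μ = entropy μ P.Astar := by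
    have hbot : P.hist 0 = ⊥ := by simp [hist, history]
    rw [hbot]
    simp only [postEntropy, condExp_bot, entropy, integral_const, probReal_univ, one_smul]
    refine Finset.sum_congr rfl fun b _ => ?_
    rw [integral_indicator (P.measurableSet_Astar_preimage b)]
    simp
  have hT : 0 ≤ ∫ ω, postEntropy (P.hist T) μ P.Astar ω ∂μ := by
    refine integral_nonneg_of_ae ?_
    filter_upwards [ae_all_iff.2 fun b => condExp_mem_Icc (P.hist_le T)
      ((integrable_const (1 : ℝ)).indicator (P.measurableSet_Astar_preimage b))
      (indicator_one_mem_Icc _)] with ω hω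
    exact Finset.sum_nonneg fun b _ => Real.negMulLog_nonneg (hω b).1 (hω b).2
  linarith

lemma integrable_regretAt (P : OnlineProblem μ 𝒜 𝒴 𝒰) (hR : P.RewardRangeLeOne) (t : ℕ) :
    Integrable (P.regretAt t) μ := by
  have hA : Measurable (P.A t) := (P.measurable_A t).mono
    (sup_le (P.hist_le t) (P.measurable_U t).comap_le) le_rfl
  have hX : Measurable P.Astar := P.measurable_Astar.mono P.sigmaPstar_le le_rfl
  refine Integrable.of_mem_Icc (-1) 1 (Measurable.aemeasurable ?_) (ae_of_all _ fun ω => ?_)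
  · exact (P.measurable_R.comp (measurable_snd.comp
      (measurable_observation hX (P.measurable_Y t)))).sub
      (P.measurable_R.comp (measurable_snd.comp (measurable_observation hA (P.measurable_Y t))))
  · have h1 := hR (P.Y t ω (P.Astar ω)) (P.Y t ω (P.A t ω))
    have h2 := hR (P.Y t ω (P.A t ω)) (P.Y t ω (P.Astar ω))
    simp only [regretAt, Set.mem_Icc]
    constructor <;> linarith

/-- A bound on the information ratio of all periods bounds the expected regret. -/
lemma integral_regret_le (P : OnlineProblem μ 𝒜 𝒴 𝒰) (hR : P.RewardRangeLeOne) {γ : ℝ}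
    (hγ : 0 ≤ γ)
    (h : ∀ t, ∀ᵐ ω ∂μ, (μ[P.regretAt t | P.hist t]) ω ^ 2 ≤ γ * P.infoGain t ω) (T : ℕ) :
    ∫ ω, P.regret T ω ∂μ ≤ √(γ * entropy μ P.Astar * T) := by
  have hsq : ∀ t, (∫ ω, P.regretAt t ω ∂μ) ^ 2 ≤ γ * ∫ ω, P.infoGain t ω ∂μ := by
    intro t
    set s := ∫ ω, P.regretAt t ω ∂μ with hs
    -- Jensen for the square, through its tangent at the mean `s`; integrability of the square is
    -- not needed.
    have h1 : ∫ ω, (2 * s * (μ[P.regretAt t | P.hist t]) ω - s ^ 2) ∂μ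
        ≤ ∫ ω, γ * P.infoGain t ω ∂μ := by
      refine integral_mono_ae ((integrable_condExp.const_mul _).sub (integrable_const _))
        ((P.integrable_infoGain t).const_mul _) ?_
      filter_upwards [h t] with ω hω
      refine le_trans ?_ hω
      linarith [sq_nonneg ((μ[P.regretAt t | P.hist t]) ω - s)]
    rw [integral_sub (integrable_condExp.const_mul _) (integrable_const _), integral_const_mul,
      integral_const_mul, integral_condExp (P.hist_le t), ← hs] at h1
    simp only [integral_const, probReal_univ, one_smul] at h1
    linarith
  have hreg : ∫ ω, P.regret T ω ∂μ = ∑ t ∈ Finset.range T, ∫ ω, P.regretAt t ω ∂μ :=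
    integral_finsetSum _ fun t _ => P.integrable_regretAt hR t
  rw [hreg]
  refine (le_abs_self _).trans (Real.abs_le_sqrt ?_)
  calc (∑ t ∈ Finset.range T, ∫ ω, P.regretAt t ω ∂μ) ^ 2
      ≤ (Finset.range T).card * ∑ t ∈ Finset.range T, (∫ ω, P.regretAt t ω ∂μ) ^ 2 :=
        sq_sum_le_card_mul_sum_sq
    _ ≤ T * ∑ t ∈ Finset.range T, γ * ∫ ω, P.infoGain t ω ∂μ := by
        rw [Finset.card_range]
        gcongr with t _
        exact hsq t
    _ ≤ T * (γ * entropy μ P.Astar) := by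
        rw [← Finset.mul_sum]
        gcongr
        exact P.sum_integral_infoGain_le T
    _ = γ * entropy μ P.Astar * T := mul_comm _ _

end OnlineProblem

end ThompsonSampling

theorem proposition5 {Ω : Type*} [MeasurableSpace Ω] (μ : Measure Ω) [IsProbabilityMeasure μ]
    {𝒴 𝒰 : Type*} [MeasurableSpace 𝒴] [MeasurableSpace 𝒰]
    (d : ℕ) (𝒜 : Finset (EuclideanSpace ℝ (Fin d)))
    (P : ThompsonSampling.OnlineProblem μ 𝒜 𝒴 𝒰)
    (hR : P.RewardRangeLeOne)
    (hTS : P.IsThompson)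
    (hlin : ∀ p ∈ P.family, ∃ θ : EuclideanSpace ℝ (Fin d), ∀ a : 𝒜,
      ∫ y, P.R y ∂(ThompsonSampling.marginal p a)
        = inner ℝ (a : EuclideanSpace ℝ (Fin d)) θ) :
    (∀ t : ℕ, ∀ᵐ ω ∂μ, P.infoRatio t ω ≤ (d : ℝ≥0∞) / 2) ∧
    (∀ T : ℕ, ∫ ω, P.regret T ω ∂μ
      ≤ Real.sqrt (ThompsonSampling.entropy μ P.Astar * d * T / 2)) := by
  -- The range of `S` contains all mean-reward vectors, and its dimension is at most `d` however
  -- many actions there are.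
  let S : EuclideanSpace ℝ (Fin d) →ₗ[ℝ] (𝒜 → ℝ) :=
    LinearMap.pi fun a => innerₗ (EuclideanSpace ℝ (Fin d)) (a : EuclideanSpace ℝ (Fin d))
  have hS : Module.finrank ℝ (LinearMap.range S) ≤ d := by
    simpa using LinearMap.finrank_range_le S
  have hmem : ∀ p ∈ P.family, (fun a : 𝒜 => ∫ y, P.R y ∂(ThompsonSampling.marginal p a))
      ∈ LinearMap.range S := by
    intro p hp
    obtain ⟨θ, hθ⟩ := hlin p hp
    exact ⟨θ, funext fun a => (hθ a).symm⟩
  have key := P.sq_condExp_regretAt_le hR hTS (LinearMap.range S) hS hmem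
  refine ⟨fun t => ?_, fun T => ?_⟩
  · filter_upwards [key t] with ω hω
    have hd : (d : ℝ≥0∞) / 2 = ENNReal.ofReal (d / 2) := by
      rw [ENNReal.ofReal_div_of_pos two_pos]
      simp
    -- The product form covers a vanishing gain: the numerator then vanishes too, and `0 / 0 = 0`.
    refine ENNReal.div_le_of_le_mul ?_
    rw [hd, ← ENNReal.ofReal_mul (by positivity)]
    exact ENNReal.ofReal_le_ofReal hω
  · refine (P.integral_regret_le hR (by positivity) key T).trans (le_of_eq ?_)
    congr 1
    ring
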